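/- Let $e_1,\dots,e_n$ be the standard orthonormal basis of $\mathbb{R}^n$; indices are raised with the Euclidean metric, repeated indices are summed, and $[\ \ ]$ is antisymmetrisation with total weight one. The wedge product is normalised so that $(\alpha\wedge\beta)_{i_1\dots i_{p+q}}=\frac{(p+q)!}{p!\,q!}\,\alpha_{[i_1\dots i_p}\beta_{i_{p+1}\dots i_{p+q}]}$. For a $2m$-form $\Omega$ on $\mathbb{R}^n$ and $k\ge m$ the duality operator $b_\Omega:\Lambda^k\mathbb{R}^n\to\Lambda^k\mathbb{R}^n$ is $$b_\Omega(F)_{i_1\dots i_k}=\Omega_{j_1\dots j_m[i_1\dots i_m}F^{j_1\dots j_m}{}_{i_{m+1}\dots i_k]} .$$ Let $\Theta$ be the $\mathfrak{spin}(7)$-invariant four-form on $\mathbb{R}^8$ with $\Theta_{ijkl}=1$ for $(ijkl)=(1245),(1276),(1346),(1357),(2356),(2437),(4567),(1238),(4358),(4718),(5168),(5728),(6248),(6738)$ (and antisymmetric, with all other components zero). Put $$e_\Theta:\Lambda^3\mathbb{R}^8\to\mathbb{R}^8,\ e_\Theta(F)_l=\Theta_{ijkl}F^{ijk},\qquad \tilde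 e_\Theta:\mathbb{R}^8\to\Lambda^3\mathbb{R}^8,\ \tilde e_\Theta(F)_{jkl}=\Theta_{ijkl}F^i .$$ Write $\mathbb{R}^{10}=\mathbb{R}^8\oplus\mathbb{R}^2$ with $\mathbb{R}^2=\mathrm{span}\{e_9,e_{10}\}$, let $\epsilon=e_9\wedge e_{10}$ and let $*$ be the Hodge operator of $\mathbb{R}^2$, determined by $\alpha\wedge *\beta=\langle\alpha,\beta\rangle\epsilon$, so that $*1=\epsilon$, $*e_9=e_{10}$, $*e_{10}=-e_9$, $*\epsilon=1$. Let $\hat\Theta=\Theta\wedge\epsilon$. Then $F\otimes\omega\mapsto F\wedge\omega$ gives an isomorphism $$\Lambda^3\mathbb{R}^8\otimes\Lambda^0\mathbb{R}^2\ \oplus\ \Lambda^2\mathbb{R}^8\otimes\mathbb{R}^2\ \oplus\ \mathbb{R}^8\otimes\Lambda^2\mathbb{R}^2\ \cong\ \Lambda^3\mathbb{R}^{10},$$ and with respect to it (over $\mathbb{R}$, and likewise over $\mathbb{C}$) $$b_{\hat\Theta}=\begin{pmatrix} & & 6\tilde e_\Theta\otimes *\\ & 3\,b_\Theta\otimes *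 & \\ e_\Theta\otimes * & & \end{pmatrix}\qquad\text{on }\Lambda^3\mathbb{R}^{10}.$$ Over $\mathbb{C}$, let $\Lambda^k_{(\beta)}\mathbb{R}^8$ be the $\beta$-eigenspace of $b_\Theta$ on $\Lambda^k\mathbb{R}^8\otimes\mathbb{C}$ and let $\mathbb{R}_\pm$ be the $\pm i$-eigenspaces of $*$ on $\mathbb{R}^2\otimes\mathbb{C}$. The eigenvalues of $b_{\hat\Theta}$ on $\Lambda^3\mathbb{R}^{10}\otimes\mathbb{C}$ are exactly the following, with the following eigenspaces and complex dimensions (in each line upper signs belong together, and so do lower signs): | eigenvalue | eigenspace | dimension | |---|---|---| | $0$ | $\Lambda^3_{(2/3)}\mathbb{R}^8$ | $48$ | | $\pm 18i$ | $\Lambda^2_{(-6)}\mathbb{R}^8\otimes\mathbb{R}_\mp$ | $7$ each | | $\pm 6i$ | $\Lambda^2_{(2)}\mathbb{R}^8\otimes\mathbb{R}_\pm$ | $21$ each | | $\pm 6\sqrt7\,i$ | $\left\{\left(\mp\tfrac{i}{\sqrt7}\tilde e_\Theta(F),\,F\wedge\epsilon\right)\,\middle|\,F\in\mathbb{R}^8\otimes\mathbb{C}\right\}$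 | $8$ each | -/

import Mathlib

noncomputable section

/-- The space `Λᵏℝⁿ` of `k`-forms on `ℝⁿ` with values in `𝕜`: for `𝕜 = ℝ` the usual `k`-forms, for
`𝕜 = ℂ` their complexification. -/
abbrev Form (𝕜 : Type*) [RCLike 𝕜] (n k : ℕ) : Type _ :=
  (Fin n → ℝ) [⋀^Fin k]→ₗ[ℝ] 𝕜

namespace Form

variable {𝕜 : Type*} [RCLike 𝕜]

/-- The standard basis of `ℝⁿ`. It is orthonormal for the Euclidean metric, so indices are raised
and lowered without any change of components: `F_{i₁…iₖ} = F (e_{i₁}, …, e_{iₖ})`. -/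
def e {n : ℕ} (i : Fin n) : Fin n → ℝ := Pi.single i 1

/-- The form `e_{I 0} ∧ ⋯ ∧ e_{I (k-1)}`; its value on `v₁, …, vₖ` is the determinant of the matrix
with entries `(v_a)_{I b}`. -/
def basis (𝕜 : Type*) [RCLike 𝕜] {n k : ℕ} (I : Fin k → Fin n) : Form 𝕜 n k :=
  (Algebra.linearMap ℝ 𝕜).compAlternatingMap
    ((Matrix.detRowAlternating (R := ℝ) (n := Fin k)).compLinearMap (LinearMap.funLeft ℝ ℝ I))

theorem append_update {α : Type*} {p q : ℕ} (w : Fin p → α) (v : Fin q → α) (i : Fin q) (x : α) :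
    Fin.append w (Function.update v i x) =
      Function.update (Fin.append w v) (Fin.natAdd p i) x := by
  funext j
  refine Fin.addCases (fun a => ?_) (fun a => ?_) j
  · rw [Fin.append_left, Function.update_of_ne, Fin.append_left]
    intro h
    have := congrArg Fin.val h
    simp at this
    omega
  · rw [Fin.append_right]
    by_cases h : a = i
    · subst h; simp
    · rw [Function.update_of_ne h, Function.update_of_ne, Fin.append_right]
      simpa using h

/-- Insertion of `w₁, …, w_p` into the first `p` slots: `(v₁, …, v_q) ↦ F (w₁, …, w_p, v₁, …, v_q)`. -/
def insert {n p q : ℕ} (w : Fin p → Fin n → ℝ) : Form 𝕜 n (p + q) →ₗ[𝕜] Form 𝕜 n q where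
  toFun F :=
    { toFun := fun v => F (Fin.append w v)
      map_update_add' := by
        intro inst v i x y
        obtain rfl : inst = instDecidableEqFin q := Subsingleton.elim _ _
        simp only [append_update]
        exact F.map_update_add _ _ _ _
      map_update_smul' := by
        intro inst v i c x
        obtain rfl : inst = instDecidableEqFin q := Subsingleton.elim _ _
        simp only [append_update]
        exact F.map_update_smul _ _ _ _
      map_eq_zero_of_eq' := by
        intro v i j h hij
        refine F.map_eq_zero_of_eq _ (i := Fin.natAdd p i) (j := Fin.natAdd p j) ?_ ?_
        · simpa using h
        · simpa using hij }
  map_add' _ _ := rfl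
  map_smul' _ _ := rfl

theorem update_comp_castAdd {α : Type*} {p q : ℕ} (v : Fin (p + q) → α) (i : Fin p) (x : α) :
    (fun a => Function.update v (Fin.castAdd q i) x (Fin.castAdd q a)) =
      Function.update (fun a => v (Fin.castAdd q a)) i x := by
  funext a
  simp [Function.update_apply]

theorem update_natAdd_comp_castAdd {α : Type*} {p q : ℕ} (v : Fin (p + q) → α) (i : Fin q) (x : α) :
    (fun a => Function.update v (Fin.natAdd p i) x (Fin.castAdd q a)) =
      fun a => v (Fin.castAdd q a) := by
  funext a
  rw [Function.update_of_ne]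
  intro h
  have := congrArg Fin.val h
  simp at this
  omega

theorem update_comp_natAdd {α : Type*} {p q : ℕ} (v : Fin (p + q) → α) (i : Fin q) (x : α) :
    (fun a => Function.update v (Fin.natAdd p i) x (Fin.natAdd p a)) =
      Function.update (fun a => v (Fin.natAdd p a)) i x := by
  funext a
  simp [Function.update_apply]

theorem update_castAdd_comp_natAdd {α : Type*} {p q : ℕ} (v : Fin (p + q) → α) (i : Fin p) (x : α) :
    (fun a => Function.update v (Fin.castAdd q i) x (Fin.natAdd p a)) =
      fun a => v (Fin.natAdd p a) := by
  funext a
  rw [Function.update_of_ne]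
  intro h
  have := congrArg Fin.val h
  simp at this
  omega

/-- The tensor product `α ⊗ β`, as the multilinear map
`(v₁, …, v_{p+q}) ↦ α (v₁, …, v_p) β (v_{p+1}, …, v_{p+q})`. -/
def tensor {n p q : ℕ} (α : Form 𝕜 n p) (β : Form 𝕜 n q) :
    MultilinearMap ℝ (fun _ : Fin (p + q) => Fin n → ℝ) 𝕜 where
  toFun v := α (fun a => v (Fin.castAdd q a)) * β (fun a => v (Fin.natAdd p a))
  map_update_add' := by
    intro inst v i x y
    obtain rfl : inst = instDecidableEqFin (p + q) := Subsingleton.elim _ _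
    refine Fin.addCases (fun i => ?_) (fun i => ?_) i
    · simp only [update_comp_castAdd, update_castAdd_comp_natAdd, AlternatingMap.map_update_add, add_mul]
    · simp only [update_natAdd_comp_castAdd, update_comp_natAdd, AlternatingMap.map_update_add, mul_add]
  map_update_smul' := by
    intro inst v i c x
    obtain rfl : inst = instDecidableEqFin (p + q) := Subsingleton.elim _ _
    refine Fin.addCases (fun i => ?_) (fun i => ?_) i
    · simp only [update_comp_castAdd, update_castAdd_comp_natAdd, AlternatingMap.map_update_smul,
        smul_mul_assoc]
    · simp only [update_natAdd_comp_castAdd, update_comp_natAdd, AlternatingMap.map_update_smul,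
        mul_smul_comm]

/-- The tensor product followed by the sum over all signed permutations of the arguments:
`(v₁, …, v_{p+q}) ↦ ∑_σ sgn(σ) (α ⊗ β) (v_{σ 1}, …, v_{σ (p+q)})`. -/
def altTensor {n p q : ℕ} : Form 𝕜 n p →ₗ[𝕜] Form 𝕜 n q →ₗ[𝕜] Form 𝕜 n (p + q) :=
  LinearMap.mk₂ 𝕜 (fun α β => MultilinearMap.alternatization (tensor α β))
    (by
      intro a a' b
      rw [← map_add]
      congr 1
      ext v
      simp [tensor, add_mul])
    (by
      intro c a b
      ext v
      simp only [MultilinearMap.alternatization_apply, AlternatingMap.smul_apply, Finset.smul_sum,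
        MultilinearMap.domDomCongr_apply]
      refine Finset.sum_congr rfl fun σ _ => ?_
      rw [smul_comm c]
      simp [tensor, mul_assoc])
    (by
      intro a b b'
      rw [← map_add]
      congr 1
      ext v
      simp [tensor, mul_add])
    (by
      intro c a b
      ext v
      simp only [MultilinearMap.alternatization_apply, AlternatingMap.smul_apply, Finset.smul_sum,
        MultilinearMap.domDomCongr_apply]
      refine Finset.sum_congr rfl fun σ _ => ?_
      rw [smul_comm c]
      simp [tensor, mul_left_comm])

/-- The antisymmetrisation, with total weight one, of the tensor product:
`α_{[i₁…i_p} β_{i_{p+1}…i_{p+q}]}`. -/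
def antisymm {n p q : ℕ} : Form 𝕜 n p →ₗ[𝕜] Form 𝕜 n q →ₗ[𝕜] Form 𝕜 n (p + q) :=
  (((p + q).factorial : 𝕜)⁻¹) • altTensor

/-- The wedge product,
`(α ∧ β)_{i₁…i_{p+q}} = (p+q)!/(p! q!) α_{[i₁…i_p} β_{i_{p+1}…i_{p+q}]}`. -/
def wedge {n p q : ℕ} : Form 𝕜 n p →ₗ[𝕜] Form 𝕜 n q →ₗ[𝕜] Form 𝕜 n (p + q) :=
  (((p.factorial * q.factorial : ℕ) : 𝕜)⁻¹) • altTensor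

/-- The contraction `F ↦ Ω_{i₁…i_p j₁…j_q} F^{i₁…i_p}` (sum over all values of all `i`). -/
def contract {n : ℕ} (p q : ℕ) (Ω : Form 𝕜 n (p + q)) : Form 𝕜 n p →ₗ[𝕜] Form 𝕜 n q where
  toFun F := ∑ I : Fin p → Fin n, F (fun a => e (I a)) • insert (fun a => e (I a)) Ω
  map_add' F G := by simp [add_smul, Finset.sum_add_distrib]
  map_smul' c F := by simp [mul_smul, Finset.smul_sum]

/-- The duality operator `b_Ω : Λᵏℝⁿ → Λᵏℝⁿ` of a `2m`-form `Ω`, for `k = m + r`: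
`b_Ω(F)_{i₁…iₖ} = Ω_{j₁…j_m [i₁…i_m} F^{j₁…j_m}_{i_{m+1}…iₖ]}`. -/
def duality {n : ℕ} (m r : ℕ) (Ω : Form 𝕜 n (m + m)) : Module.End 𝕜 (Form 𝕜 n (m + r)) where
  toFun F := ∑ J : Fin m → Fin n,
    antisymm (insert (fun a => e (J a)) Ω) (insert (fun a => e (J a)) F)
  map_add' F G := by simp [Finset.sum_add_distrib]
  map_smul' c F := by simp [Finset.smul_sum]

/-- The volume form `e₁ ∧ ⋯ ∧ eₙ` of `ℝⁿ`. -/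
def vol (𝕜 : Type*) [RCLike 𝕜] (n : ℕ) : Form 𝕜 n n := basis 𝕜 id

/-- The Hodge operator `* : Λᵖℝⁿ → Λ^qℝⁿ`, `n = p + q`:
`(*F)_{j₁…j_q} = 1/p! F^{i₁…i_p} vol_{i₁…i_p j₁…j_q}`, that is `α ∧ *F = ⟨α, F⟩ vol`. -/
def hodge (p q : ℕ) : Form 𝕜 (p + q) p →ₗ[𝕜] Form 𝕜 (p + q) q :=
  ((p.factorial : 𝕜)⁻¹) • contract p q (vol 𝕜 (p + q))

/-- The inclusion `Λᵏℝ⁸ → Λᵏℝ¹⁰` given by `ℝ¹⁰ = ℝ⁸ ⊕ ℝ²` (pull-back along the orthogonal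
projection onto the first eight coordinates). -/
def pull8 {k : ℕ} : Form 𝕜 8 k →ₗ[𝕜] Form 𝕜 10 k where
  toFun F := F.compLinearMap (LinearMap.funLeft ℝ ℝ (Fin.castAdd 2 : Fin 8 → Fin 10))
  map_add' _ _ := rfl
  map_smul' _ _ := rfl

/-- The inclusion `Λᵏℝ² → Λᵏℝ¹⁰` given by `ℝ¹⁰ = ℝ⁸ ⊕ ℝ²` (pull-back along the orthogonal
projection onto the last two coordinates). -/
def pull2 {k : ℕ} : Form 𝕜 2 k →ₗ[𝕜] Form 𝕜 10 k where
  toFun F := F.compLinearMap (LinearMap.funLeft ℝ ℝ (Fin.natAdd 8 : Fin 2 → Fin 10))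
  map_add' _ _ := rfl
  map_smul' _ _ := rfl

/-- The bilinear map `(F, ω) ↦ F ∧ ω` from `Λᵖℝ⁸ × Λ^qℝ²` to `Λ^{p+q}ℝ¹⁰`. -/
def join (p q : ℕ) : Form 𝕜 8 p →ₗ[𝕜] Form 𝕜 2 q →ₗ[𝕜] Form 𝕜 10 (p + q) :=
  wedge.compl₁₂ pull8 pull2

open scoped TensorProduct in
/-- The right-hand side `Λ³ℝ⁸ ⊗ Λ⁰ℝ² ⊕ Λ²ℝ⁸ ⊗ ℝ² ⊕ ℝ⁸ ⊗ Λ²ℝ²` of the decomposition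
of `Λ³ℝ¹⁰`. -/
abbrev Split (𝕜 : Type*) [RCLike 𝕜] : Type _ :=
  (Form 𝕜 8 3 ⊗[𝕜] Form 𝕜 2 0) × (Form 𝕜 8 2 ⊗[𝕜] Form 𝕜 2 1) × (Form 𝕜 8 1 ⊗[𝕜] Form 𝕜 2 2)

/-- The identification of `Λ³ℝ⁸ ⊗ Λ⁰ℝ² ⊕ Λ²ℝ⁸ ⊗ ℝ² ⊕ ℝ⁸ ⊗ Λ²ℝ²` with `Λ³ℝ¹⁰`, given by
`F ⊗ ω ↦ F ∧ ω` on each summand. -/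
def assemble (𝕜 : Type*) [RCLike 𝕜] : Split 𝕜 →ₗ[𝕜] Form 𝕜 10 3 :=
  (TensorProduct.lift (join 3 0)).coprod
    ((TensorProduct.lift (join 2 1)).coprod (TensorProduct.lift (join 1 2)))

/-- The `spin(7)`-invariant four-form on `ℝ⁸` (indices are shifted by one, to start at `0`). -/
def Theta (𝕜 : Type*) [RCLike 𝕜] : Form 𝕜 8 4 :=
  basis 𝕜 ![0, 1, 3, 4] + basis 𝕜 ![0, 1, 6, 5] + basis 𝕜 ![0, 2, 3, 5] + basis 𝕜 ![0, 2, 4, 6] +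
  basis 𝕜 ![1, 2, 4, 5] + basis 𝕜 ![1, 3, 2, 6] + basis 𝕜 ![3, 4, 5, 6] +
  basis 𝕜 ![0, 1, 2, 7] + basis 𝕜 ![3, 2, 4, 7] + basis 𝕜 ![3, 6, 0, 7] + basis 𝕜 ![4, 0, 5, 7] +
  basis 𝕜 ![4, 6, 1, 7] + basis 𝕜 ![5, 1, 3, 7] + basis 𝕜 ![5, 6, 2, 7]

/-- The volume form `ε` of `ℝ²`. -/
def eps (𝕜 : Type*) [RCLike 𝕜] : Form 𝕜 2 2 := vol 𝕜 2

/-- The six-form `Θ̂ = Θ ∧ ε` on `ℝ¹⁰`. -/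
def ThetaHat (𝕜 : Type*) [RCLike 𝕜] : Form 𝕜 10 6 := join 4 2 (Theta 𝕜) (eps 𝕜)

/-- `b_Θ : Λ²ℝ⁸ → Λ²ℝ⁸`, `b_Θ(F)_{kl} = Θ_{ijkl} F^{ij}`. -/
def bTheta2 (𝕜 : Type*) [RCLike 𝕜] : Module.End 𝕜 (Form 𝕜 8 2) := duality 2 0 (Theta 𝕜)

/-- `b_Θ : Λ³ℝ⁸ → Λ³ℝ⁸`, `b_Θ(F)_{lmn} = Θ_{ij[lm} F^{ij}_{n]}`. -/
def bTheta3 (𝕜 : Type*) [RCLike 𝕜] : Module.End 𝕜 (Form 𝕜 8 3) := duality 2 1 (Theta 𝕜)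

/-- `b_Θ̂ : Λ³ℝ¹⁰ → Λ³ℝ¹⁰`, `b_Θ̂(F)_{lmn} = Θ̂_{ijklmn} F^{ijk}`. -/
def bThetaHat (𝕜 : Type*) [RCLike 𝕜] : Module.End 𝕜 (Form 𝕜 10 3) := duality 3 0 (ThetaHat 𝕜)

/-- `e_Θ : Λ³ℝ⁸ → ℝ⁸`, `e_Θ(F)_l = Θ_{ijkl} F^{ijk}`. -/
def eTheta (𝕜 : Type*) [RCLike 𝕜] : Form 𝕜 8 3 →ₗ[𝕜] Form 𝕜 8 1 := contract 3 1 (Theta 𝕜)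

/-- `ẽ_Θ : ℝ⁸ → Λ³ℝ⁸`, `ẽ_Θ(F)_{jkl} = Θ_{ijkl} F^i`. -/
def eThetaTilde (𝕜 : Type*) [RCLike 𝕜] : Form 𝕜 8 1 →ₗ[𝕜] Form 𝕜 8 3 := contract 1 3 (Theta 𝕜)

/-- The Hodge operator of `ℝ²` on functions, `*1 = ε`. -/
def star0 (𝕜 : Type*) [RCLike 𝕜] : Form 𝕜 2 0 →ₗ[𝕜] Form 𝕜 2 2 := hodge 0 2

/-- The Hodge operator of `ℝ²` on one-forms, a rotation by a right angle. -/
def star1 (𝕜 : Type*) [RCLike 𝕜] : Module.End 𝕜 (Form 𝕜 2 1) := hodge 1 1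

/-- The Hodge operator of `ℝ²` on two-forms, `*ε = 1`. -/
def star2 (𝕜 : Type*) [RCLike 𝕜] : Form 𝕜 2 2 →ₗ[𝕜] Form 𝕜 2 0 := hodge 2 0

/-- The block operator
`(x₁, x₂, x₃) ↦ ((6 ẽ_Θ ⊗ *) x₃, (3 b_Θ ⊗ *) x₂, (e_Θ ⊗ *) x₁)`. -/
def blockOp (𝕜 : Type*) [RCLike 𝕜] : Module.End 𝕜 (Split 𝕜) where
  toFun x :=
    (TensorProduct.map ((6 : 𝕜) • eThetaTilde 𝕜) (star2 𝕜) x.2.2,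
     TensorProduct.map ((3 : 𝕜) • bTheta2 𝕜) (star1 𝕜) x.2.1,
     TensorProduct.map (eTheta 𝕜) (star0 𝕜) x.1)
  map_add' x y := by simp
  map_smul' c x := by simp

/-- `Λ²_{(β)}ℝ⁸`, the `β`-eigenspace of `b_Θ` on (complex) two-forms. -/
def eig2 (β : ℂ) : Submodule ℂ (Form ℂ 8 2) := (bTheta2 ℂ).eigenspace β

/-- `Λ³_{(β)}ℝ⁸`, the `β`-eigenspace of `b_Θ` on (complex) three-forms. -/
def eig3 (β : ℂ) : Submodule ℂ (Form ℂ 8 3) := (bTheta3 ℂ).eigenspace β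

/-- `ℝ_+`, the `i`-eigenspace of the Hodge operator on the (complexified) plane. -/
def RPlus : Submodule ℂ (Form ℂ 2 1) := (star1 ℂ).eigenspace Complex.I

/-- `ℝ_-`, the `-i`-eigenspace of the Hodge operator on the (complexified) plane. -/
def RMinus : Submodule ℂ (Form ℂ 2 1) := (star1 ℂ).eigenspace (-Complex.I)

/-- The subspace `A ⊗ B ⊆ Λᵖℝ⁸ ⊗ Λ^qℝ² ⊆ Λ^{p+q}ℝ¹⁰`, spanned by the forms `F ∧ ω` with `F ∈ A`
and `ω ∈ B`. -/
def tens {p q : ℕ} (A : Submodule ℂ (Form ℂ 8 p)) (B : Submodule ℂ (Form ℂ 2 q)) :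
    Submodule ℂ (Form ℂ 10 (p + q)) :=
  Submodule.map₂ (join p q) A B

/-- The form `(c ẽ_Θ(F), F ∧ ε)` in `Λ³ℝ⁸ ⊕ ℝ⁸ ⊗ Λ²ℝ² ⊆ Λ³ℝ¹⁰`. -/
def mixed (c : ℂ) (F : Form ℂ 8 1) : Form ℂ 10 3 :=
  pull8 (c • eThetaTilde ℂ F) + join 1 2 F (eps ℂ)

end Form

end

/-! A three-form on ℝ¹⁰ is uniquely F + G ∧ e₉ + H ∧ e₁₀ + K ∧ ε with F, G, H, K forms on ℝ⁸. A
component of `ThetaHat` is nonzero only when exactly two of its six indices lie in ℝ². So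
contracting three of them turns (F, G, H, K) into (6 ẽ(K), -3 b(H), 3 b(G), e(F)), which is the
block form (`parts_bThetaHat`, `bThetaHat_comp_assemble`).

The spectrum then follows from three identities on ℝ⁸, which come from the explicit components of Θ:
b² = 12 - 4b on two-forms (`bTheta2_sq`), e ∘ ẽ = -42 on one-forms (`eTheta_eThetaTilde`), and 9b =
6 + ẽ ∘ e on three-forms (`nine_smul_bTheta3`).

The first identity gives b the eigenvalues 2 and -6 on two-forms. Since b is traceless on a space of
dimension 28, their multiplicities are 21 and 7. On Λ²ℝ⁸ ⊗ ℝ² the operator is 3b ⊗ *, with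
eigenvalues 3βs for β in {2, -6} and s = ±i. On Λ³ℝ⁸ ⊕ ℝ⁸ ⊗ Λ²ℝ² the equations 6 ẽ(K) = μF and e(F)
= μK force μ² = 6 · (-42) = -252 unless K = 0. When μ² = -252, F = (6/μ) ẽ(K) and K is free, of
dimension 8. When K = 0 and F ≠ 0, μ = 0 and F lies in ker e. By the other two identities this
kernel is the 2/3-eigenspace of b, of dimension 56 - 8 = 48.

The values of μ² on the two blocks, namely -324, -36 on the first and -252, 0 on the second, are
distinct. So no eigenspace mixes the blocks. -/

noncomputable section

namespace Form

section General

variable {𝕜 : Type*} [RCLike 𝕜]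

/-! ### Components as linear coordinates; dimension and trace -/

/-- The component `F_{I 0 … I (k-1)}` of a form. -/
def coeff {n k : ℕ} (F : Form 𝕜 n k) (I : Fin k → Fin n) : 𝕜 := F fun a => e (I a)

@[simp]
theorem coeff_add {n k : ℕ} (F G : Form 𝕜 n k) (I : Fin k → Fin n) :
    coeff (F + G) I = coeff F I + coeff G I := rfl

@[simp]
theorem coeff_smul {n k : ℕ} (c : 𝕜) (F : Form 𝕜 n k) (I : Fin k → Fin n) :
    coeff (c • F) I = c * coeff F I := rfl

@[simp]
theorem coeff_neg {n k : ℕ} (F : Form 𝕜 n k) (I : Fin k → Fin n) :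
    coeff (-F) I = -coeff F I := rfl

@[simp]
theorem coeff_sub {n k : ℕ} (F G : Form 𝕜 n k) (I : Fin k → Fin n) :
    coeff (F - G) I = coeff F I - coeff G I := rfl

@[simp]
theorem coeff_zero {n k : ℕ} (I : Fin k → Fin n) : coeff (0 : Form 𝕜 n k) I = 0 := rfl

theorem coeff_sum {n k : ℕ} {ι : Type*} (s : Finset ι) (F : ι → Form 𝕜 n k) (I : Fin k → Fin n) :
    coeff (∑ i ∈ s, F i) I = ∑ i ∈ s, coeff (F i) I := by
  classical
  induction s using Finset.induction_on with
  | empty => simp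
  | insert a s ha ih => rw [Finset.sum_insert ha, Finset.sum_insert ha, coeff_add, ih]

theorem coeff_comp_perm {n k : ℕ} (F : Form 𝕜 n k) (I : Fin k → Fin n)
    (σ : Equiv.Perm (Fin k)) :
    coeff F (I ∘ σ) = ((Equiv.Perm.sign σ : ℤ) : 𝕜) * coeff F I := by
  have h := F.map_perm (fun a => e (I a)) σ
  change F ((fun a => e (I a)) ∘ σ) = _
  rw [h, Units.smul_def, zsmul_eq_mul]
  rfl

theorem coeff_eq_zero {n k : ℕ} (F : Form 𝕜 n k) (I : Fin k → Fin n) {a b : Fin k}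
    (h : I a = I b) (hab : a ≠ b) : coeff F I = 0 :=
  F.map_eq_zero_of_eq _ (by simp only [h]) hab

/-- Sorting an injective multi-index changes a component only by a sign, and a repeated index gives
zero, so increasing indices suffice. -/
theorem ext_coeff {n k : ℕ} {F G : Form 𝕜 n k}
    (h : ∀ I : Fin k → Fin n, StrictMono I → coeff F I = coeff G I) : F = G := by
  refine (Pi.basisFun ℝ (Fin n)).ext_alternating fun I hI => ?_
  have hs : StrictMono (I ∘ Tuple.sort I) :=
    (Tuple.monotone_sort I).strictMono_of_injective (hI.comp (Tuple.sort I).injective)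
  have key := h _ hs
  rw [coeff_comp_perm, coeff_comp_perm] at key
  have h0 : (((Equiv.Perm.sign (Tuple.sort I) : ℤˣ) : ℤ) : 𝕜) ≠ 0 := by
    exact_mod_cast (Equiv.Perm.sign (Tuple.sort I)).ne_zero
  have := mul_left_cancel₀ h0 key
  simpa [coeff, e, Pi.basisFun_apply] using this

/-- `(e_{I 0} ∧ ⋯)(e_{J 0}, …)` is the determinant of the matrix of Kronecker deltas. -/
theorem coeff_basis {n k : ℕ} (I J : Fin k → Fin n) :
    coeff (basis 𝕜 I) J =
      (Matrix.of fun a b => if I b = J a then (1 : 𝕜) else 0).det := by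
  have : coeff (basis 𝕜 I) J =
      algebraMap ℝ 𝕜 (Matrix.of fun a b => if I b = J a then (1 : ℝ) else 0).det := by
    simp only [coeff, basis, LinearMap.compAlternatingMap_apply, Algebra.linearMap_apply,
      AlternatingMap.compLinearMap_apply, Matrix.detRowAlternating]
    congr 2
    ext a b
    simp [e, Pi.single_apply]
  rw [this, RingHom.map_det]
  congr 1
  ext a b
  simp only [RingHom.mapMatrix_apply, Matrix.map_apply, Matrix.of_apply]
  split_ifs <;> simp

theorem coeff_basis_eq_zero {n k : ℕ} {I J : Fin k → Fin n} (a : Fin k) (h : ∀ b, I b ≠ J a) :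
    coeff (basis 𝕜 I) J = 0 := by
  rw [coeff_basis]
  exact Matrix.det_eq_zero_of_row_eq_zero a fun b => by simp [h b]

theorem coeff_basis_self {n k : ℕ} {I : Fin k → Fin n} (hI : Function.Injective I) :
    coeff (basis 𝕜 I) I = 1 := by
  rw [coeff_basis]
  convert Matrix.det_one (n := Fin k) (R := 𝕜)
  ext a b
  simp [Matrix.one_apply, hI.eq_iff, eq_comm]

/-- If some index of J is missing from I, the determinant has a zero row. Otherwise the two ranges
agree by cardinality, and an increasing map is determined by its range. -/
theorem coeff_basis_orderEmb {n k : ℕ} (I J : Fin k ↪o Fin n) :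
    coeff (basis 𝕜 I) J = if I = J then 1 else 0 := by
  split_ifs with h
  · subst h
    exact coeff_basis_self I.injective
  · by_contra hne
    apply h
    have hsub : Set.range J ⊆ Set.range I := by
      rintro _ ⟨a, rfl⟩
      by_contra hc
      exact hne (coeff_basis_eq_zero a fun b hb => hc ⟨b, hb⟩)
    have hEq : Set.range I = Set.range J := by
      have h1 : Finset.univ.image J ⊆ Finset.univ.image I := by
        intro x hx
        have : x ∈ Set.range I := hsub (by simpa using hx)
        simpa using this
      have h2 := Finset.eq_of_subset_of_card_le h1 (by
        rw [Finset.card_image_of_injective _ I.injective,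
          Finset.card_image_of_injective _ J.injective])
      have h3 := congrArg (fun s : Finset (Fin n) => (s : Set (Fin n))) h2
      simpa using h3.symm
    exact DFunLike.coe_injective
      ((I.strictMono.range_inj J.strictMono).1 hEq)

/-- Components with increasing indices are linear coordinates on `Λᵏℝⁿ`. -/
def coeffEquiv (𝕜 : Type*) [RCLike 𝕜] (n k : ℕ) : Form 𝕜 n k ≃ₗ[𝕜] ((Fin k ↪o Fin n) → 𝕜) :=
  LinearEquiv.ofBijective
    ({ toFun := fun F I => coeff F I
       map_add' := fun _ _ => rfl
       map_smul' := fun _ _ => rfl } : Form 𝕜 n k →ₗ[𝕜] ((Fin k ↪o Fin n) → 𝕜))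
    (by
      constructor
      · intro F G h
        refine ext_coeff fun I hI => ?_
        exact congrFun h (OrderEmbedding.ofStrictMono I hI)
      · intro c
        refine ⟨∑ I : Fin k ↪o Fin n, c I • basis 𝕜 I, ?_⟩
        funext J
        change coeff (∑ I : Fin k ↪o Fin n, c I • basis 𝕜 I) J = c J
        simp [coeff_sum, coeff_basis_orderEmb])

@[simp]
theorem coeffEquiv_apply {n k : ℕ} (F : Form 𝕜 n k) (I : Fin k ↪o Fin n) :
    coeffEquiv 𝕜 n k F I = coeff F I := rfl

instance instFiniteForm {n k : ℕ} : Module.Finite 𝕜 (Form 𝕜 n k) :=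
  Module.Finite.equiv (coeffEquiv 𝕜 n k).symm

theorem finrank_form (n k : ℕ) : Module.finrank 𝕜 (Form 𝕜 n k) = n.choose k := by
  rw [(coeffEquiv 𝕜 n k).finrank_eq, Module.finrank_fintype_fun_eq_card, ← Nat.card_eq_fintype_card,
    Nat.card_congr (Set.powersetCard.ofFinEmbEquiv (n := k) (I := Fin n)), Set.powersetCard.card]
  simp

theorem trace_eq_sum_coeff {n k : ℕ} (T : Module.End 𝕜 (Form 𝕜 n k)) :
    LinearMap.trace 𝕜 _ T = ∑ I : Fin k ↪o Fin n, coeff (T (basis 𝕜 I)) I := by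
  classical
  rw [LinearMap.trace_eq_matrix_trace 𝕜 (Module.Basis.ofEquivFun (coeffEquiv 𝕜 n k)), Matrix.trace]
  refine Finset.sum_congr rfl fun I _ => ?_
  have : (coeffEquiv 𝕜 n k).symm (Pi.single I 1) = basis 𝕜 I := by
    rw [LinearEquiv.symm_apply_eq]
    funext J
    simp [coeff_basis_orderEmb, Pi.single_apply, eq_comm]
  rw [Matrix.diag_apply, LinearMap.toMatrix_apply, Module.Basis.ofEquivFun_repr_apply,
    coeffEquiv_apply, Module.Basis.coe_ofEquivFun]
  simp only [this]

/-! ### Components of F ∧ ω on ℝ⁸ ⊕ ℝ² -/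

theorem funLeft_castAdd_e_castAdd (i : Fin 8) :
    LinearMap.funLeft ℝ ℝ (Fin.castAdd 2 : Fin 8 → Fin 10) (e (Fin.castAdd 2 i)) = e i := by
  funext j
  simp [e, LinearMap.funLeft_apply, Pi.single_apply, Fin.ext_iff]

theorem funLeft_castAdd_e_of_le {x : Fin 10} (hx : 8 ≤ (x : ℕ)) :
    LinearMap.funLeft ℝ ℝ (Fin.castAdd 2 : Fin 8 → Fin 10) (e x) = 0 := by
  funext j
  have : Fin.castAdd 2 j ≠ x := by
    rintro rfl
    have := j.2
    simp at hx
    omega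
  simp [e, LinearMap.funLeft_apply, this]

theorem funLeft_natAdd_e_natAdd (i : Fin 2) :
    LinearMap.funLeft ℝ ℝ (Fin.natAdd 8 : Fin 2 → Fin 10) (e (Fin.natAdd 8 i)) = e i := by
  funext j
  simp [e, LinearMap.funLeft_apply, Pi.single_apply, Fin.ext_iff]

theorem funLeft_natAdd_e_of_lt {x : Fin 10} (hx : (x : ℕ) < 8) :
    LinearMap.funLeft ℝ ℝ (Fin.natAdd 8 : Fin 2 → Fin 10) (e x) = 0 := by
  funext j
  have : Fin.natAdd 8 j ≠ x := by
    rintro rfl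
    simp at hx
  simp [e, LinearMap.funLeft_apply, this]

theorem coeff_pull8_castAdd {k : ℕ} (F : Form 𝕜 8 k) (u : Fin k → Fin 8) :
    coeff (pull8 F) (fun a => Fin.castAdd 2 (u a)) = coeff F u := by
  change F _ = F _
  congr 1
  funext a
  exact funLeft_castAdd_e_castAdd (u a)

theorem coeff_pull8_eq_zero {k : ℕ} (F : Form 𝕜 8 k) {I : Fin k → Fin 10} (a : Fin k)
    (h : 8 ≤ (I a : ℕ)) : coeff (pull8 F) I = 0 :=
  F.map_coord_zero a (funLeft_castAdd_e_of_le h)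

theorem coeff_pull2_natAdd {k : ℕ} (F : Form 𝕜 2 k) (u : Fin k → Fin 2) :
    coeff (pull2 F) (fun a => Fin.natAdd 8 (u a)) = coeff F u := by
  change F _ = F _
  congr 1
  funext a
  exact funLeft_natAdd_e_natAdd (u a)

theorem coeff_pull2_eq_zero {k : ℕ} (F : Form 𝕜 2 k) {I : Fin k → Fin 10} (a : Fin k)
    (h : (I a : ℕ) < 8) : coeff (pull2 F) I = 0 :=
  F.map_coord_zero a (funLeft_natAdd_e_of_lt h)

theorem coeff_altTensor {n p q : ℕ} (α : Form 𝕜 n p) (β : Form 𝕜 n q) (K : Fin (p + q) → Fin n) :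
    coeff (altTensor α β) K = ∑ σ : Equiv.Perm (Fin (p + q)), ((Equiv.Perm.sign σ : ℤ) : 𝕜) *
      (coeff α (fun a => K (σ (Fin.castAdd q a))) * coeff β (fun a => K (σ (Fin.natAdd p a)))) := by
  change MultilinearMap.alternatization (tensor α β) (fun a => e (K a)) = _
  rw [MultilinearMap.alternatization_apply]
  refine Finset.sum_congr rfl fun σ _ => ?_
  rw [Units.smul_def, zsmul_eq_mul]
  rfl

theorem coeff_join {p q : ℕ} (F : Form 𝕜 8 p) (ω : Form 𝕜 2 q) (K : Fin (p + q) → Fin 10) :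
    coeff (join p q F ω) K = ((p.factorial * q.factorial : ℕ) : 𝕜)⁻¹ *
      ∑ σ : Equiv.Perm (Fin (p + q)), ((Equiv.Perm.sign σ : ℤ) : 𝕜) *
        (coeff (pull8 F) (fun a => K (σ (Fin.castAdd q a))) *
          coeff (pull2 ω) (fun a => K (σ (Fin.natAdd p a)))) := by
  rw [← coeff_altTensor]
  rfl

/-- A form `F ∧ ω` of bidegree `(p, q)` vanishes unless exactly `p` of its arguments lie in `ℝ⁸`. -/
theorem coeff_join_eq_zero {p q : ℕ} (F : Form 𝕜 8 p) (ω : Form 𝕜 2 q) {K : Fin (p + q) → Fin 10}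
    (h : ∑ x, (if (K x : ℕ) < 8 then 1 else 0) ≠ p) : coeff (join p q F ω) K = 0 := by
  rw [coeff_join, Finset.sum_eq_zero, mul_zero]
  intro σ _
  by_cases h1 : ∃ a, 8 ≤ (K (σ (Fin.castAdd q a)) : ℕ)
  · obtain ⟨a, ha⟩ := h1
    rw [coeff_pull8_eq_zero F a ha]; simp
  by_cases h2 : ∃ a, (K (σ (Fin.natAdd p a)) : ℕ) < 8
  · obtain ⟨a, ha⟩ := h2
    rw [coeff_pull2_eq_zero ω a ha]; simp
  push Not at h1 h2
  exfalso
  apply h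
  rw [← Equiv.sum_comp σ, Fin.sum_univ_add]
  simp [h1, fun a => not_lt.2 (h2 a)]

/-- Only permutations preserving the two blocks of arguments contribute. There are p! q! of them and
their signs cancel against those of F and ω, so each contributes the same product; the normalisation
of the wedge product removes the count. -/
theorem coeff_join_append {p q : ℕ} (F : Form 𝕜 8 p) (ω : Form 𝕜 2 q) (u : Fin p → Fin 8)
    (w : Fin q → Fin 2) :
    coeff (join p q F ω) (Fin.append (fun a => Fin.castAdd 2 (u a)) (fun b => Fin.natAdd 8 (w b))) =
      coeff F u * coeff ω w := by
  classical
  rw [coeff_join]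
  set K : Fin (p + q) → Fin 10 :=
    Fin.append (fun a => Fin.castAdd 2 (u a)) (fun b => Fin.natAdd 8 (w b)) with hK
  let φ : Equiv.Perm (Fin p) × Equiv.Perm (Fin q) → Equiv.Perm (Fin (p + q)) :=
    fun ρ => finSumFinEquiv.permCongr (Equiv.Perm.sumCongr ρ.1 ρ.2)
  have hφ : Function.Injective φ := by
    intro ρ ρ' h
    have h1 : Equiv.Perm.sumCongr ρ.1 ρ.2 = Equiv.Perm.sumCongr ρ'.1 ρ'.2 :=
      finSumFinEquiv.permCongr.injective h
    exact Equiv.Perm.sumCongrHom_injective (a₁ := ρ) (a₂ := ρ') h1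
  have hl (ρ) (a : Fin p) : φ ρ (Fin.castAdd q a) = Fin.castAdd q (ρ.1 a) := by
    simp [φ, Equiv.permCongr_apply]
  have hr (ρ) (a : Fin q) : φ ρ (Fin.natAdd p a) = Fin.natAdd p (ρ.2 a) := by
    simp [φ, Equiv.permCongr_apply]
  have hs (ρ) : ((Equiv.Perm.sign (φ ρ) : ℤ) : 𝕜) =
      ((Equiv.Perm.sign ρ.1 : ℤ) : 𝕜) * ((Equiv.Perm.sign ρ.2 : ℤ) : 𝕜) := by
    simp [φ, Equiv.Perm.sign_permCongr, Equiv.Perm.sign_sumCongr]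
  have hsq {k : ℕ} (ρ : Equiv.Perm (Fin k)) :
      ((Equiv.Perm.sign ρ : ℤ) : 𝕜) * ((Equiv.Perm.sign ρ : ℤ) : 𝕜) = 1 := by
    rw [← Int.cast_mul, ← Units.val_mul, Int.units_mul_self]; simp
  rw [← Finset.sum_subset (Finset.subset_univ (Finset.univ.image φ)),
    Finset.sum_image hφ.injOn]
  · have (ρ : Equiv.Perm (Fin p) × Equiv.Perm (Fin q)) :
        ((Equiv.Perm.sign (φ ρ) : ℤ) : 𝕜) *
        (coeff (pull8 F) (fun a => K (φ ρ (Fin.castAdd q a))) *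
          coeff (pull2 ω) (fun a => K (φ ρ (Fin.natAdd p a)))) = coeff F u * coeff ω w := by
      simp only [hl, hr, hK, Fin.append_left, Fin.append_right]
      rw [coeff_pull8_castAdd F (fun a => u (ρ.1 a)), coeff_pull2_natAdd ω (fun a => w (ρ.2 a))]
      have h1 := coeff_comp_perm F u ρ.1
      have h2 := coeff_comp_perm ω w ρ.2
      simp only [Function.comp_def] at h1 h2
      rw [h1, h2, hs]
      linear_combination (coeff F u * coeff ω w * ((Equiv.Perm.sign ρ.2 : ℤ) : 𝕜) ^ 2) *
        hsq ρ.1 + (coeff F u * coeff ω w) * hsq ρ.2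
    simp only [this, Finset.sum_const, Finset.card_univ, Fintype.card_prod, Fintype.card_perm,
      Fintype.card_fin, nsmul_eq_mul]
    rw [← mul_assoc, inv_mul_cancel₀, one_mul]
    exact_mod_cast (Nat.mul_pos p.factorial_pos q.factorial_pos).ne'
  · intro σ _ hσ
    by_cases h1 : ∃ a, 8 ≤ (K (σ (Fin.castAdd q a)) : ℕ)
    · obtain ⟨a, ha⟩ := h1
      rw [coeff_pull8_eq_zero F a ha]; simp
    push Not at h1
    exfalso
    apply hσ
    -- A permutation that feeds F only arguments from ℝ⁸ maps the first block to itself, hence is a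
    -- pair of permutations, one for each block.
    have hmaps : Set.MapsTo (finSumFinEquiv.symm.permCongr σ)
        (Set.range (Sum.inl : Fin p → Fin p ⊕ Fin q)) (Set.range Sum.inl) := by
      rintro _ ⟨a, rfl⟩
      have ha := h1 a
      simp only [Equiv.permCongr_apply, Equiv.symm_symm, finSumFinEquiv_apply_left]
      generalize σ (Fin.castAdd q a) = y at ha
      refine Fin.addCases (fun b hb => ?_) (fun b hb => ?_) y ha
      · exact ⟨b, by simp⟩
      · rw [hK, Fin.append_right] at hb
        simp at hb
    obtain ⟨ρ, hρ⟩ := Equiv.Perm.mem_sumCongrHom_range_of_perm_mapsTo_inl hmaps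
    refine Finset.mem_image.2 ⟨ρ, Finset.mem_univ _, ?_⟩
    change finSumFinEquiv.permCongr (Equiv.Perm.sumCongrHom _ _ ρ) = σ
    rw [hρ]
    ext x
    simp [Equiv.permCongr_apply]

/-! ### Contractions and sums over index tuples -/

/-- The index of `ℝ¹⁰` given by an index of `ℝ⁸`. -/
def lo (i : Fin 8) : Fin 10 := Fin.castAdd 2 i

/-- The index of `ℝ¹⁰` given by an index of `ℝ²`. -/
def hi (a : Fin 2) : Fin 10 := Fin.natAdd 8 a

@[simp]
theorem val_lo_lt (i : Fin 8) : (lo i : ℕ) < 8 := i.2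

@[simp]
theorem not_val_hi_lt (a : Fin 2) : ¬ (hi a : ℕ) < 8 := by simp [hi]

theorem coeff_insert {n p q : ℕ} (F : Form 𝕜 n (p + q)) (J : Fin p → Fin n) (K : Fin q → Fin n) :
    coeff (insert (fun a => e (J a)) F) K = coeff F (Fin.append J K) := by
  change F _ = F _
  congr 1
  funext x
  refine Fin.addCases (fun a => ?_) (fun a => ?_) x <;> simp

theorem coeff_contract {n p q : ℕ} (Ω : Form 𝕜 n (p + q)) (F : Form 𝕜 n p) (K : Fin q → Fin n) :
    coeff (contract p q Ω F) K = ∑ J, coeff F J * coeff Ω (Fin.append J K) := by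
  change coeff (∑ J : Fin p → Fin n, coeff F J • insert (fun a => e (J a)) Ω) K = _
  simp only [coeff_sum, coeff_smul, coeff_insert]

theorem sign_mul_self {k : ℕ} (σ : Equiv.Perm (Fin k)) :
    ((Equiv.Perm.sign σ : ℤ) : 𝕜) * ((Equiv.Perm.sign σ : ℤ) : 𝕜) = 1 := by
  rw [← Int.cast_mul, ← Units.val_mul, Int.units_mul_self]; simp

/-- Total weight one makes antisymmetrisation the identity on a form that is already alternating.
Hence for k = m the duality operator is a plain contraction. -/
theorem coeff_antisymm_zero {n p : ℕ} (α : Form 𝕜 n p) (c : Form 𝕜 n 0) (K : Fin p → Fin n) :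
    coeff (antisymm α c) K = coeff α K * coeff c Fin.elim0 := by
  change ((p.factorial : 𝕜)⁻¹) * coeff (altTensor α c) K = _
  rw [coeff_altTensor]
  have (σ : Equiv.Perm (Fin p)) : ((Equiv.Perm.sign σ : ℤ) : 𝕜) *
      (coeff α (fun a => K (σ a)) * coeff c (fun a => K (σ (Fin.natAdd p a)))) =
      coeff α K * coeff c Fin.elim0 := by
    have h := coeff_comp_perm α K σ
    simp only [Function.comp_def] at h
    rw [h, show (fun a : Fin 0 => K (σ (Fin.natAdd p a))) = Fin.elim0 from Subsingleton.elim _ _]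
    linear_combination (coeff α K * coeff c Fin.elim0) * sign_mul_self (𝕜 := 𝕜) σ
  have hsum := Fintype.sum_congr _ _ this
  refine (congrArg (fun t => ((p.factorial : 𝕜)⁻¹) * t) hsum).trans ?_
  simp only [Finset.sum_const, Finset.card_univ, Fintype.card_perm, Fintype.card_fin, nsmul_eq_mul]
  rw [← mul_assoc, inv_mul_cancel₀, one_mul]
  exact_mod_cast p.factorial_ne_zero

theorem coeff_duality_zero {n m : ℕ} (Ω : Form 𝕜 n (m + m)) (F : Form 𝕜 n m) (K : Fin m → Fin n) :
    coeff (duality m 0 Ω F) K = ∑ J, coeff F J * coeff Ω (Fin.append J K) := by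
  change coeff (∑ J : Fin m → Fin n, antisymm (insert (fun a => e (J a)) Ω)
    (insert (p := m) (q := 0) (fun a => e (J a)) F)) K = _
  rw [coeff_sum]
  refine Finset.sum_congr rfl fun J _ => ?_
  have h : coeff (insert (p := m) (q := 0) (fun a => e (J a)) F) Fin.elim0 = coeff F J := by
    rw [coeff_insert]
    exact congrArg (coeff F) (Fin.append_elim0 J)
  rw [coeff_antisymm_zero, coeff_insert, h, mul_comm]

theorem sum_vec_succ {M α : Type*} [AddCommMonoid M] [Fintype α] {k : ℕ}
    (g : (Fin (k + 1) → α) → M) :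
    ∑ J, g J = ∑ i, ∑ J : Fin k → α, g (Matrix.vecCons i J) := by
  rw [← (Fin.consEquiv (fun _ : Fin (k + 1) => α)).sum_comp, Fintype.sum_prod_type]
  rfl

theorem sum_vec_one {M α : Type*} [AddCommMonoid M] [Fintype α] (g : (Fin 1 → α) → M) :
    ∑ J, g J = ∑ i, g ![i] := by
  rw [sum_vec_succ]
  refine Finset.sum_congr rfl fun i _ => ?_
  rw [Fintype.sum_subsingleton _ ![]]

theorem sum_vec_two {M α : Type*} [AddCommMonoid M] [Fintype α] (g : (Fin 2 → α) → M) :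
    ∑ J, g J = ∑ i, ∑ j, g ![i, j] := by
  simp only [sum_vec_succ (k := 1), sum_vec_one]

theorem sum_vec_three {M α : Type*} [AddCommMonoid M] [Fintype α] (g : (Fin 3 → α) → M) :
    ∑ J, g J = ∑ i, ∑ j, ∑ k, g ![i, j, k] := by
  simp only [sum_vec_succ (k := 2), sum_vec_two]

/-- A sum over triples of a symmetric summand, sorted by the number of entries in `ℝ²`. -/
theorem sum_split_symm (g : Fin 10 → Fin 10 → Fin 10 → 𝕜) (h₁ : ∀ i j k, g i j k = g j i k)
    (h₂ : ∀ i j k, g i j k = g i k j) :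
    ∑ i, ∑ j, ∑ k, g i j k =
      (∑ i : Fin 8, ∑ j : Fin 8, ∑ k : Fin 8,
        g (lo i) (lo j) (lo k)) +
      3 * (∑ i : Fin 8, ∑ j : Fin 8, ∑ a : Fin 2,
        g (lo i) (lo j) (hi a)) +
      3 * (∑ i : Fin 8, ∑ a : Fin 2, ∑ b : Fin 2,
        g (lo i) (hi a) (hi b)) +
      ∑ a : Fin 2, ∑ b : Fin 2, ∑ c : Fin 2,
        g (hi a) (hi b) (hi c) := by
  have hs (f : Fin 10 → 𝕜) : ∑ i, f i =
      ∑ i : Fin 8, f (lo i) + ∑ a : Fin 2, f (hi a) :=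
    Fin.sum_univ_add (a := 8) (b := 2) f
  simp only [hs, Finset.sum_add_distrib]
  have e1 : ∑ i : Fin 8, ∑ a : Fin 2, ∑ j : Fin 8,
      g (lo i) (hi a) (lo j) =
      ∑ i : Fin 8, ∑ j : Fin 8, ∑ a : Fin 2,
        g (lo i) (lo j) (hi a) := by
    refine Finset.sum_congr rfl fun i _ => ?_
    rw [Finset.sum_comm]
    exact Finset.sum_congr rfl fun j _ => Finset.sum_congr rfl fun a _ => h₂ _ _ _
  have e2 : ∑ a : Fin 2, ∑ i : Fin 8, ∑ j : Fin 8,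
      g (hi a) (lo i) (lo j) =
      ∑ i : Fin 8, ∑ j : Fin 8, ∑ a : Fin 2,
        g (lo i) (lo j) (hi a) := by
    rw [Finset.sum_comm, ← e1]
    exact Finset.sum_congr rfl fun j _ => Finset.sum_congr rfl fun a _ =>
      Finset.sum_congr rfl fun _ _ => h₁ _ _ _
  have e3 : ∑ a : Fin 2, ∑ i : Fin 8, ∑ b : Fin 2,
      g (hi a) (lo i) (hi b) =
      ∑ i : Fin 8, ∑ a : Fin 2, ∑ b : Fin 2,
        g (lo i) (hi a) (hi b) := by
    rw [Finset.sum_comm]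
    exact Finset.sum_congr rfl fun j _ => Finset.sum_congr rfl fun a _ =>
      Finset.sum_congr rfl fun _ _ => h₁ _ _ _
  have e4 : ∑ a : Fin 2, ∑ b : Fin 2, ∑ i : Fin 8,
      g (hi a) (hi b) (lo i) =
      ∑ i : Fin 8, ∑ a : Fin 2, ∑ b : Fin 2,
        g (lo i) (hi a) (hi b) := by
    rw [← e3]
    refine Finset.sum_congr rfl fun a _ => ?_
    rw [Finset.sum_comm]
    exact Finset.sum_congr rfl fun j _ => Finset.sum_congr rfl fun a _ => h₂ _ _ _
  rw [e1, e2, e3, e4]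
  ring

theorem coeff_swap01 {n : ℕ} (F : Form 𝕜 n 3) (i j k : Fin n) :
    coeff F ![j, i, k] = -coeff F ![i, j, k] := by
  have h := coeff_comp_perm F ![i, j, k] (Equiv.swap 0 1)
  rw [Equiv.Perm.sign_swap (by decide)] at h
  rw [show ![j, i, k] = ![i, j, k] ∘ Equiv.swap 0 1 by
    funext x; fin_cases x <;> rfl, h]
  simp

theorem coeff_swap12 {n : ℕ} (F : Form 𝕜 n 3) (i j k : Fin n) :
    coeff F ![i, k, j] = -coeff F ![i, j, k] := by
  have h := coeff_comp_perm F ![i, j, k] (Equiv.swap 1 2)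
  rw [Equiv.Perm.sign_swap (by decide)] at h
  rw [show ![i, k, j] = ![i, j, k] ∘ Equiv.swap 1 2 by
    funext x; fin_cases x <;> rfl, h]
  simp

theorem coeff_rot {n : ℕ} (F : Form 𝕜 n 3) (i j k : Fin n) :
    coeff F ![k, i, j] = coeff F ![i, j, k] := by
  rw [coeff_swap01, coeff_swap12, neg_neg]

theorem coeff_swap {n : ℕ} (F : Form 𝕜 n 2) (i j : Fin n) :
    coeff F ![j, i] = -coeff F ![i, j] := by
  have h := coeff_comp_perm F ![i, j] (Equiv.swap 0 1)
  rw [Equiv.Perm.sign_swap (by decide)] at h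
  rw [show ![j, i] = ![i, j] ∘ Equiv.swap 0 1 by
    funext x; fin_cases x <;> rfl, h]
  simp

/-! ### Components of Θ̂ and of its duality operator -/

/-- The components of `Θ̂` on arguments in the order `ℝ⁸, ℝ⁸, ℝ⁸, ℝ⁸, ℝ², ℝ²`, permuted by `σ`. -/
theorem coeff_ThetaHat {K : Fin 6 → Fin 10} (σ : Equiv.Perm (Fin 6)) (hσ : Equiv.Perm.sign σ = 1)
    (u : Fin 4 → Fin 8) (w : Fin 2 → Fin 2)
    (h : ∀ x, K (σ x) =
      Fin.append (fun a => lo (u a)) (fun b => hi (w b)) x) :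
    coeff (ThetaHat 𝕜) K = coeff (Theta 𝕜) u * coeff (eps 𝕜) w := by
  rw [← coeff_join_append]
  have h1 := coeff_comp_perm (ThetaHat 𝕜) K σ
  rw [hσ, show K ∘ σ = _ from funext h] at h1
  simpa [ThetaHat, lo, hi] using h1.symm

/-- No sign appears because one index of ℝ² passes two indices of ℝ⁸. In `coeff_ThetaHat_one` two
pass three, which is again even. -/
theorem coeff_ThetaHat_two (i j l m : Fin 8) (a b : Fin 2) :
    coeff (ThetaHat 𝕜) (Fin.append ![lo i, lo j, hi a]
      ![lo l, lo m, hi b]) =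
      coeff (Theta 𝕜) ![i, j, l, m] * coeff (eps 𝕜) ![a, b] := by
  refine coeff_ThetaHat ⟨![0, 1, 3, 4, 2, 5], ![0, 1, 4, 2, 3, 5], by decide, by decide⟩ (by decide)
    _ _ fun x => ?_
  fin_cases x <;> rfl

theorem coeff_ThetaHat_one (i l m n : Fin 8) (a b : Fin 2) :
    coeff (ThetaHat 𝕜) (Fin.append ![lo i, hi a, hi b]
      ![lo l, lo m, lo n]) =
      coeff (Theta 𝕜) ![i, l, m, n] * coeff (eps 𝕜) ![a, b] := by
  refine coeff_ThetaHat ⟨![0, 3, 4, 5, 1, 2], ![0, 4, 5, 1, 2, 3], by decide, by decide⟩ (by decide)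
    _ _ fun x => ?_
  fin_cases x <;> rfl

theorem coeff_ThetaHat_three (i j k l : Fin 8) (a b : Fin 2) :
    coeff (ThetaHat 𝕜) (Fin.append ![lo i, lo j, lo k]
      ![lo l, hi a, hi b]) =
      coeff (Theta 𝕜) ![i, j, k, l] * coeff (eps 𝕜) ![a, b] := by
  refine coeff_ThetaHat 1 (by decide) _ _ fun x => ?_
  fin_cases x <;> rfl

theorem coeff_ThetaHat_eq_zero (x y z x' y' z' : Fin 10)
    (h : (if (x : ℕ) < 8 then 1 else 0) + ((if (y : ℕ) < 8 then 1 else 0) +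
      ((if (z : ℕ) < 8 then 1 else 0) + ((if (x' : ℕ) < 8 then 1 else 0) +
      ((if (y' : ℕ) < 8 then 1 else 0) + (if (z' : ℕ) < 8 then 1 else 0))))) ≠ 4) :
    coeff (ThetaHat 𝕜) (Fin.append ![x, y, z] ![x', y', z']) = 0 := by
  refine coeff_join_eq_zero (p := 4) (q := 2) _ _ fun h' => h ?_
  rw [← h']
  simp only [Fin.sum_univ_succ (n := 5), Fin.sum_univ_succ (n := 4), Fin.sum_univ_succ (n := 3),
    Fin.sum_univ_succ (n := 2), Fin.sum_univ_succ (n := 1), Fin.sum_univ_succ (n := 0),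
    Finset.univ_eq_empty, Finset.sum_empty, add_zero]
  rfl

theorem coeff_eps (a b : Fin 2) : coeff (eps 𝕜) ![a, b] =
    if a = b then 0 else if a = 0 then 1 else -1 := by
  change coeff (basis 𝕜 _) _ = _
  rw [coeff_basis, Matrix.det_fin_two]
  fin_cases a <;> fin_cases b <;> simp

/-- The components of `b_Θ̂`, with the sum sorted by the number of contracted indices in `ℝ²`. -/
theorem coeff_bThetaHat (H : Form 𝕜 10 3) (x y z : Fin 10) :
    coeff (bThetaHat 𝕜 H) ![x, y, z] =
      (∑ i : Fin 8, ∑ j : Fin 8, ∑ k : Fin 8,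
        coeff H ![lo i, lo j, lo k] * coeff (ThetaHat 𝕜)
          (Fin.append ![lo i, lo j, lo k] ![x, y, z])) +
      3 * (∑ i : Fin 8, ∑ j : Fin 8, ∑ a : Fin 2,
        coeff H ![lo i, lo j, hi a] * coeff (ThetaHat 𝕜)
          (Fin.append ![lo i, lo j, hi a] ![x, y, z])) +
      3 * (∑ i : Fin 8, ∑ a : Fin 2, ∑ b : Fin 2,
        coeff H ![lo i, hi a, hi b] * coeff (ThetaHat 𝕜)
          (Fin.append ![lo i, hi a, hi b] ![x, y, z])) +
      ∑ a : Fin 2, ∑ b : Fin 2, ∑ c : Fin 2,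
        coeff H ![hi a, hi b, hi c] * coeff (ThetaHat 𝕜)
          (Fin.append ![hi a, hi b, hi c] ![x, y, z]) := by
  have h := coeff_duality_zero (ThetaHat 𝕜) H ![x, y, z]
  rw [sum_vec_three] at h
  -- Exchanging the two triples of slots has sign (-1)⁹ = -1. It presents the component as that of a
  -- three-form in J, so the summand is a product of two alternating factors and is symmetric, as
  -- `sum_split_symm` needs.
  have hΩ (J : Fin 3 → Fin 10) : coeff (ThetaHat 𝕜) (Fin.append J ![x, y, z]) =
      coeff (insert (p := 3) (q := 3) (fun a => e (![x, y, z] a)) (ThetaHat 𝕜)) J *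
        (-1) := by
    rw [coeff_insert]
    have h2 := coeff_comp_perm (ThetaHat 𝕜) (Fin.append ![x, y, z] J)
      ⟨![3, 4, 5, 0, 1, 2], ![3, 4, 5, 0, 1, 2], by decide, by decide⟩
    rw [show Equiv.Perm.sign (⟨![3, 4, 5, 0, 1, 2], ![3, 4, 5, 0, 1, 2], by decide, by decide⟩ :
      Equiv.Perm (Fin 6)) = -1 by decide] at h2
    rw [show Fin.append J ![x, y, z] = Fin.append ![x, y, z] J ∘ ![3, 4, 5, 0, 1, 2] by
      funext t; fin_cases t <;> rfl]
    refine h2.trans ?_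
    push_cast
    ring
  rw [← sum_split_symm (fun i j k => coeff H ![i, j, k] * coeff (ThetaHat 𝕜)
    (Fin.append ![i, j, k] ![x, y, z]))]
  · exact h
  · intro i j k
    rw [hΩ, hΩ, coeff_swap01 _ j i, coeff_swap01 _ j i]
    ring
  · intro i j k
    rw [hΩ, hΩ, coeff_swap12 _ i k j, coeff_swap12 _ i k j]
    ring

/-! ### The four parts of a three-form and the block form in terms of them -/

open scoped TensorProduct

/-- Restriction of a form on `ℝ¹⁰` to `ℝ⁸`. -/
def restrict8 {k : ℕ} : Form 𝕜 10 k →ₗ[𝕜] Form 𝕜 8 k where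
  toFun F := F.compLinearMap (Function.ExtendByZero.linearMap ℝ (Fin.castAdd 2 : Fin 8 → Fin 10))
  map_add' _ _ := rfl
  map_smul' _ _ := rfl

theorem coeff_restrict8 {k : ℕ} (F : Form 𝕜 10 k) (I : Fin k → Fin 8) :
    coeff (restrict8 F) I = coeff F (fun a => lo (I a)) := by
  change F _ = F _
  congr 1
  funext a
  change Function.extend (Fin.castAdd 2 : Fin 8 → Fin 10) (e (I a)) 0 = e (lo (I a))
  funext x
  by_cases hx : ∃ y : Fin 8, Fin.castAdd 2 y = x
  · obtain ⟨y, rfl⟩ := hx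
    rw [(Fin.castAdd_injective 8 2).extend_apply]
    simp [e, Pi.single_apply, Fin.ext_iff, lo]
  · rw [Function.extend_apply' _ _ _ hx]
    have : x ≠ lo (I a) := fun h => hx ⟨_, h.symm⟩
    simp [e, this]

/-- The triples of forms on `ℝ⁸` that describe a three-form on `ℝ¹⁰`. -/
abbrev Parts (𝕜 : Type*) [RCLike 𝕜] : Type _ :=
  Form 𝕜 8 3 × Form 𝕜 8 2 × Form 𝕜 8 2 × Form 𝕜 8 1

/-- The parts `(F, G, H, K)` of the form `F + G ∧ e₉ + H ∧ e₁₀ + K ∧ ε`. -/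
def parts (𝕜 : Type*) [RCLike 𝕜] : Form 𝕜 10 3 →ₗ[𝕜] Parts 𝕜 :=
  restrict8.prod
    ((restrict8 ∘ₗ insert (p := 1) (q := 2) (fun a => e (![hi 0] a))).prod
      ((restrict8 ∘ₗ insert (p := 1) (q := 2) (fun a => e (![hi 1] a))).prod
        (restrict8 ∘ₗ insert (p := 2) (q := 1)
          (fun a => e (![hi 0, hi 1] a)))))

theorem coeff_parts_one (H : Form 𝕜 10 3) (i j k : Fin 8) :
    coeff (parts 𝕜 H).1 ![i, j, k] =
      coeff H ![lo i, lo j, lo k] := by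
  change coeff (restrict8 H) _ = _
  rw [coeff_restrict8]
  congr 1
  funext x; fin_cases x <;> rfl

theorem coeff_parts_insert (H : Form 𝕜 10 3) (a : Fin 2) (i j : Fin 8) :
    coeff (restrict8 (insert (p := 1) (q := 2) (fun t => e (![hi a] t)) H)) ![i, j] =
      coeff H ![lo i, lo j, hi a] := by
  rw [coeff_restrict8, coeff_insert, ← coeff_rot]
  congr 1
  funext x; fin_cases x <;> rfl

theorem coeff_parts_two (H : Form 𝕜 10 3) (i j : Fin 8) :
    coeff (parts 𝕜 H).2.1 ![i, j] =
      coeff H ![lo i, lo j, hi 0] :=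
  coeff_parts_insert H 0 i j

theorem coeff_parts_three (H : Form 𝕜 10 3) (i j : Fin 8) :
    coeff (parts 𝕜 H).2.2.1 ![i, j] =
      coeff H ![lo i, lo j, hi 1] :=
  coeff_parts_insert H 1 i j

theorem coeff_parts_four (H : Form 𝕜 10 3) (i : Fin 8) :
    coeff (parts 𝕜 H).2.2.2 ![i] =
      coeff H ![lo i, hi 0, hi 1] := by
  change coeff (restrict8 (insert (p := 2) (q := 1)
    (fun t => e (![hi 0, hi 1] t)) H)) ![i] = _
  rw [coeff_restrict8, coeff_insert, ← coeff_rot, ← coeff_rot]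
  congr 1
  funext x; fin_cases x <;> rfl

theorem ext_coeff_one {n : ℕ} {F G : Form 𝕜 n 1} (h : ∀ i, coeff F ![i] = coeff G ![i]) :
    F = G := by
  refine ext_coeff fun I _ => ?_
  rw [show I = ![I 0] by funext x; fin_cases x; rfl]
  exact h _

theorem ext_coeff_two {n : ℕ} {F G : Form 𝕜 n 2}
    (h : ∀ i j, i < j → coeff F ![i, j] = coeff G ![i, j]) : F = G := by
  refine ext_coeff fun I hI => ?_
  rw [show I = ![I 0, I 1] by funext x; fin_cases x <;> rfl]
  exact h _ _ (hI (by decide))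

theorem ext_coeff_three {n : ℕ} {F G : Form 𝕜 n 3}
    (h : ∀ i j k, i < j → j < k → coeff F ![i, j, k] = coeff G ![i, j, k]) : F = G := by
  refine ext_coeff fun I hI => ?_
  rw [show I = ![I 0, I 1, I 2] by funext x; fin_cases x <;> rfl]
  exact h _ _ _ (hI (by decide)) (hI (by decide))

/-- An increasing triple of indices ends with none, one or both of the two indices of ℝ², and each
of these cases is read off from one of the parts. -/
theorem parts_injective : Function.Injective (parts 𝕜) := by
  intro H H' h
  have h1 (i j k) := (coeff_parts_one H i j k).symm.trans
    ((by rw [h] : _ = _).trans (coeff_parts_one H' i j k))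
  have h2 (i j) := (coeff_parts_two H i j).symm.trans
    ((by rw [h] : _ = _).trans (coeff_parts_two H' i j))
  have h3 (i j) := (coeff_parts_three H i j).symm.trans
    ((by rw [h] : _ = _).trans (coeff_parts_three H' i j))
  have h4 (i) := (coeff_parts_four H i).symm.trans
    ((by rw [h] : _ = _).trans (coeff_parts_four H' i))
  refine ext_coeff_three fun x y z => ?_
  refine Fin.addCases (m := 8) (n := 2) (fun i => ?_) (fun a => ?_) x <;>
  refine Fin.addCases (m := 8) (n := 2) (fun j => ?_) (fun b => ?_) y <;>
  refine Fin.addCases (m := 8) (n := 2) (fun k => ?_) (fun c => ?_) z <;>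
  intro hxy hyz
  · exact h1 i j k
  · fin_cases c
    · exact h2 i j
    · exact h3 i j
  · rw [Fin.lt_def] at hyz
    simp at hyz; omega
  · rw [Fin.lt_def] at hyz
    have : b = 0 ∧ c = 1 := by simp at hyz; omega
    rw [this.1, this.2]
    exact h4 i
  all_goals
    rw [Fin.lt_def] at hxy hyz
    simp at hxy hyz
    omega

/-- The operator `b_Θ̂` in terms of parts. -/
def partsOp (𝕜 : Type*) [RCLike 𝕜] (x : Parts 𝕜) : Parts 𝕜 :=
  ((6 : 𝕜) • eThetaTilde 𝕜 x.2.2.2, (-3 : 𝕜) • bTheta2 𝕜 x.2.2.1, (3 : 𝕜) • bTheta2 𝕜 x.2.1,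
    eTheta 𝕜 x.1)

theorem coeff_eThetaTilde (K : Form 𝕜 8 1) (l m n : Fin 8) :
    coeff (eThetaTilde 𝕜 K) ![l, m, n] = ∑ i, coeff K ![i] * coeff (Theta 𝕜) ![i, l, m, n] := by
  refine (coeff_contract (p := 1) (q := 3) (Theta 𝕜) K ![l, m, n]).trans ?_
  rw [sum_vec_one]
  refine Finset.sum_congr rfl fun i _ => ?_
  congr 2
  funext x; fin_cases x <;> rfl

theorem coeff_eTheta (F : Form 𝕜 8 3) (l : Fin 8) :
    coeff (eTheta 𝕜 F) ![l] =
      ∑ i, ∑ j, ∑ k, coeff F ![i, j, k] * coeff (Theta 𝕜) ![i, j, k, l] := by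
  refine (coeff_contract (p := 3) (q := 1) (Theta 𝕜) F ![l]).trans ?_
  rw [sum_vec_three]
  refine Finset.sum_congr rfl fun i _ => Finset.sum_congr rfl fun j _ =>
    Finset.sum_congr rfl fun k _ => ?_
  congr 2
  funext x; fin_cases x <;> rfl

theorem coeff_bTheta2 (G : Form 𝕜 8 2) (l m : Fin 8) :
    coeff (bTheta2 𝕜 G) ![l, m] = ∑ i, ∑ j, coeff G ![i, j] * coeff (Theta 𝕜) ![i, j, l, m] := by
  have h := coeff_duality_zero (n := 8) (m := 2) (Theta 𝕜) G ![l, m]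
  refine h.trans ?_
  rw [sum_vec_two]
  refine Finset.sum_congr rfl fun i _ => Finset.sum_congr rfl fun j _ => ?_
  congr 2
  funext x; fin_cases x <;> rfl

/-- The free slots fix how many contracted indices lie in ℝ²: two, one or none. One such index can
occupy 3 positions, whence ±3 with the sign of ε. Two can occupy 3 pairs of positions in 2 orders,
whence 6. -/
theorem parts_bThetaHat (H : Form 𝕜 10 3) :
    parts 𝕜 (bThetaHat 𝕜 H) = partsOp 𝕜 (parts 𝕜 H) := by
  refine Prod.ext ?_ (Prod.ext ?_ (Prod.ext ?_ ?_))
  · refine ext_coeff_three fun l m n _ _ => ?_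
    rw [coeff_parts_one, coeff_bThetaHat]
    simp only [partsOp, coeff_smul, coeff_eThetaTilde, coeff_parts_four]
    simp (disch := simp) only [coeff_ThetaHat_one, coeff_ThetaHat_eq_zero, mul_zero,
      Finset.sum_const_zero]
    simp only [Fin.sum_univ_two, coeff_eps]
    simp only [coeff_swap12 H _ (hi 0) (hi 1)]
    simp [Finset.mul_sum]
    refine Finset.sum_congr rfl fun i _ => ?_
    ring
  · refine ext_coeff_two fun l m _ => ?_
    rw [coeff_parts_two, coeff_bThetaHat]
    simp only [partsOp, coeff_smul, coeff_bTheta2, coeff_parts_three]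
    simp (disch := simp) only [coeff_ThetaHat_two, coeff_ThetaHat_eq_zero, mul_zero,
      Finset.sum_const_zero]
    simp only [Fin.sum_univ_two, coeff_eps]
    simp
  · refine ext_coeff_two fun l m _ => ?_
    rw [coeff_parts_three, coeff_bThetaHat]
    simp only [partsOp, coeff_smul, coeff_bTheta2, coeff_parts_two]
    simp (disch := simp) only [coeff_ThetaHat_two, coeff_ThetaHat_eq_zero, mul_zero,
      Finset.sum_const_zero]
    simp only [Fin.sum_univ_two, coeff_eps]
    simp
  · refine ext_coeff_one fun l => ?_
    rw [coeff_parts_four, coeff_bThetaHat]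
    simp only [partsOp, coeff_eTheta, coeff_parts_one]
    simp (disch := simp) only [coeff_ThetaHat_three, coeff_ThetaHat_eq_zero, mul_zero,
      Finset.sum_const_zero]
    simp [coeff_eps]

/-! ### The tensor decomposition, the Hodge operator of ℝ² and the block operator -/

/-- The function `1` on `ℝ²`. -/
def one2 (𝕜 : Type*) [RCLike 𝕜] : Form 𝕜 2 0 := basis 𝕜 ![]

/-- The one-form `e_a` on `ℝ²`. -/
def dual2 (𝕜 : Type*) [RCLike 𝕜] (a : Fin 2) : Form 𝕜 2 1 := basis 𝕜 ![a]

theorem coeff_one2 (I : Fin 0 → Fin 2) : coeff (one2 𝕜) I = 1 := by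
  rw [one2, coeff_basis, Matrix.det_isEmpty]

theorem coeff_dual2 (a b : Fin 2) : coeff (dual2 𝕜 a) ![b] = if a = b then 1 else 0 := by
  rw [dual2, coeff_basis, Matrix.det_unique]
  rfl

theorem coeff_join_three_zero (F : Form 𝕜 8 3) (ω : Form 𝕜 2 0) (i j k : Fin 8) :
    coeff (join 3 0 F ω) ![lo i, lo j, lo k] = coeff F ![i, j, k] * coeff ω ![] := by
  rw [← coeff_join_append]
  congr 1
  funext x; fin_cases x <;> rfl

theorem coeff_join_two_one (F : Form 𝕜 8 2) (ω : Form 𝕜 2 1) (i j : Fin 8) (a : Fin 2) :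
    coeff (join 2 1 F ω) ![lo i, lo j, hi a] = coeff F ![i, j] * coeff ω ![a] := by
  rw [← coeff_join_append]
  congr 1
  funext x; fin_cases x <;> rfl

theorem coeff_join_one_two (F : Form 𝕜 8 1) (ω : Form 𝕜 2 2) (i : Fin 8) (a b : Fin 2) :
    coeff (join 1 2 F ω) ![lo i, hi a, hi b] = coeff F ![i] * coeff ω ![a, b] := by
  rw [← coeff_join_append]
  congr 1
  funext x; fin_cases x <;> rfl

theorem parts_join_three_zero (F : Form 𝕜 8 3) (ω : Form 𝕜 2 0) :
    parts 𝕜 (join 3 0 F ω) = (coeff ω ![] • F, 0, 0, 0) := by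
  refine Prod.ext ?_ (Prod.ext ?_ (Prod.ext ?_ ?_))
  · refine ext_coeff_three fun i j k _ _ => ?_
    rw [coeff_parts_one, coeff_join_three_zero, coeff_smul, mul_comm]
  · refine ext_coeff_two fun i j _ => ?_
    rw [coeff_parts_two]
    exact coeff_join_eq_zero _ _ fun h => absurd ((Fin.sum_univ_three _).symm.trans h) (by simp)
  · refine ext_coeff_two fun i j _ => ?_
    rw [coeff_parts_three]
    exact coeff_join_eq_zero _ _ fun h => absurd ((Fin.sum_univ_three _).symm.trans h) (by simp)
  · refine ext_coeff_one fun i => ?_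
    rw [coeff_parts_four]
    exact coeff_join_eq_zero _ _ fun h => absurd ((Fin.sum_univ_three _).symm.trans h) (by simp)

theorem parts_join_two_one (F : Form 𝕜 8 2) (ω : Form 𝕜 2 1) :
    parts 𝕜 (join 2 1 F ω) = (0, coeff ω ![0] • F, coeff ω ![1] • F, 0) := by
  refine Prod.ext ?_ (Prod.ext ?_ (Prod.ext ?_ ?_))
  · refine ext_coeff_three fun i j k _ _ => ?_
    rw [coeff_parts_one]
    exact coeff_join_eq_zero _ _ fun h => absurd ((Fin.sum_univ_three _).symm.trans h) (by simp)
  · refine ext_coeff_two fun i j _ => ?_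
    rw [coeff_parts_two, coeff_join_two_one, coeff_smul, mul_comm]
  · refine ext_coeff_two fun i j _ => ?_
    rw [coeff_parts_three, coeff_join_two_one, coeff_smul, mul_comm]
  · refine ext_coeff_one fun i => ?_
    rw [coeff_parts_four]
    exact coeff_join_eq_zero _ _ fun h => absurd ((Fin.sum_univ_three _).symm.trans h) (by simp)

theorem parts_join_one_two (F : Form 𝕜 8 1) (ω : Form 𝕜 2 2) :
    parts 𝕜 (join 1 2 F ω) = (0, 0, 0, coeff ω ![0, 1] • F) := by
  refine Prod.ext ?_ (Prod.ext ?_ (Prod.ext ?_ ?_))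
  · refine ext_coeff_three fun i j k _ _ => ?_
    rw [coeff_parts_one]
    exact coeff_join_eq_zero _ _ fun h => absurd ((Fin.sum_univ_three _).symm.trans h) (by simp)
  · refine ext_coeff_two fun i j _ => ?_
    rw [coeff_parts_two]
    exact coeff_join_eq_zero _ _ fun h => absurd ((Fin.sum_univ_three _).symm.trans h) (by simp)
  · refine ext_coeff_two fun i j _ => ?_
    rw [coeff_parts_three]
    exact coeff_join_eq_zero _ _ fun h => absurd ((Fin.sum_univ_three _).symm.trans h) (by simp)
  · refine ext_coeff_one fun i => ?_
    rw [coeff_parts_four, coeff_join_one_two, coeff_smul, mul_comm]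

theorem parts_pull8 (F : Form 𝕜 8 3) : parts 𝕜 (pull8 F) = (F, 0, 0, 0) := by
  have h1 (a : Fin 2) : 8 ≤ (hi a : ℕ) := by simp [hi]
  refine Prod.ext ?_ (Prod.ext ?_ (Prod.ext ?_ ?_))
  · refine ext_coeff_three fun i j k _ _ => ?_
    rw [coeff_parts_one, ← coeff_pull8_castAdd]
    congr 1
    funext x; fin_cases x <;> rfl
  · refine ext_coeff_two fun i j _ => ?_
    rw [coeff_parts_two]
    exact coeff_pull8_eq_zero _ 2 (h1 0)
  · refine ext_coeff_two fun i j _ => ?_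
    rw [coeff_parts_three]
    exact coeff_pull8_eq_zero _ 2 (h1 1)
  · refine ext_coeff_one fun i => ?_
    rw [coeff_parts_four]
    exact coeff_pull8_eq_zero _ 2 (h1 1)

/-- `(F, G, H, K) ↦ (F ⊗ 1, G ⊗ e₉ + H ⊗ e₁₀, K ⊗ ε)`. -/
def splitOfParts (x : Parts 𝕜) : Split 𝕜 :=
  (x.1 ⊗ₜ one2 𝕜, x.2.1 ⊗ₜ dual2 𝕜 0 + x.2.2.1 ⊗ₜ dual2 𝕜 1, x.2.2.2 ⊗ₜ eps 𝕜)

theorem parts_assemble_splitOfParts (x : Parts 𝕜) :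
    parts 𝕜 (assemble 𝕜 (splitOfParts x)) = x := by
  obtain ⟨F, G, H, K⟩ := x
  simp [splitOfParts, assemble, parts_join_three_zero, parts_join_two_one, parts_join_one_two,
    coeff_one2, coeff_dual2, coeff_eps]

theorem eq_coeff_smul_one2 (ω : Form 𝕜 2 0) : ω = coeff ω ![] • one2 𝕜 := by
  refine ext_coeff fun I _ => ?_
  rw [coeff_smul, coeff_one2, mul_one, Subsingleton.elim I ![]]

theorem eq_coeff_smul_dual2 (ω : Form 𝕜 2 1) :
    ω = coeff ω ![0] • dual2 𝕜 0 + coeff ω ![1] • dual2 𝕜 1 := by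
  refine ext_coeff_one fun i => ?_
  fin_cases i <;> simp [coeff_dual2]

theorem eq_coeff_smul_eps (ω : Form 𝕜 2 2) : ω = coeff ω ![0, 1] • eps 𝕜 := by
  refine ext_coeff_two fun i j hij => ?_
  have : i = 0 ∧ j = 1 := by omega
  simp [this.1, this.2, coeff_eps]

/-- Each tensor factor on ℝ² has an explicit basis: 1, then e₉ and e₁₀, then ε. Scalars move across
to the forms on ℝ⁸, so statements about tensors can be tested on quadruples of forms. -/
theorem splitOfParts_surjective : Function.Surjective (splitOfParts (𝕜 := 𝕜)) := by
  have h1 (t : Form 𝕜 8 3 ⊗[𝕜] Form 𝕜 2 0) : ∃ F, t = F ⊗ₜ one2 𝕜 := by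
    induction t using TensorProduct.induction_on with
    | zero => exact ⟨0, by simp⟩
    | tmul F ω =>
      refine ⟨coeff ω ![] • F, ?_⟩
      rw [TensorProduct.smul_tmul, ← eq_coeff_smul_one2]
    | add s t hs ht =>
      obtain ⟨F, rfl⟩ := hs
      obtain ⟨G, rfl⟩ := ht
      exact ⟨F + G, by rw [TensorProduct.add_tmul]⟩
  have h2 (t : Form 𝕜 8 2 ⊗[𝕜] Form 𝕜 2 1) :
      ∃ G H, t = G ⊗ₜ dual2 𝕜 0 + H ⊗ₜ dual2 𝕜 1 := by
    induction t using TensorProduct.induction_on with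
    | zero => exact ⟨0, 0, by simp⟩
    | tmul F ω =>
      refine ⟨coeff ω ![0] • F, coeff ω ![1] • F, ?_⟩
      rw [TensorProduct.smul_tmul, TensorProduct.smul_tmul, ← TensorProduct.tmul_add,
        ← eq_coeff_smul_dual2]
    | add s t hs ht =>
      obtain ⟨G, H, rfl⟩ := hs
      obtain ⟨G', H', rfl⟩ := ht
      exact ⟨G + G', H + H', by rw [TensorProduct.add_tmul, TensorProduct.add_tmul]; abel⟩
  have h3 (t : Form 𝕜 8 1 ⊗[𝕜] Form 𝕜 2 2) : ∃ K, t = K ⊗ₜ eps 𝕜 := by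
    induction t using TensorProduct.induction_on with
    | zero => exact ⟨0, by simp⟩
    | tmul F ω =>
      refine ⟨coeff ω ![0, 1] • F, ?_⟩
      rw [TensorProduct.smul_tmul, ← eq_coeff_smul_eps]
    | add s t hs ht =>
      obtain ⟨F, rfl⟩ := hs
      obtain ⟨G, rfl⟩ := ht
      exact ⟨F + G, by rw [TensorProduct.add_tmul]⟩
  rintro ⟨s, t, u⟩
  obtain ⟨F, rfl⟩ := h1 s
  obtain ⟨G, H, rfl⟩ := h2 t
  obtain ⟨K, rfl⟩ := h3 u
  exact ⟨(F, G, H, K), rfl⟩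

/-- Taking parts after assembling inverts `splitOfParts` on the left. Surjectivity of `splitOfParts`
then gives injectivity here, and injectivity of `parts` gives surjectivity. -/
theorem assemble_bijective : Function.Bijective (assemble 𝕜) := by
  constructor
  · intro s t h
    obtain ⟨x, rfl⟩ := splitOfParts_surjective s
    obtain ⟨y, rfl⟩ := splitOfParts_surjective t
    rw [← parts_assemble_splitOfParts x, h, parts_assemble_splitOfParts]
  · intro H
    exact ⟨splitOfParts (parts 𝕜 H), parts_injective (parts_assemble_splitOfParts _)⟩

theorem star0_one2 : star0 𝕜 (one2 𝕜) = eps 𝕜 := by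
  refine ext_coeff_two fun i j _ => ?_
  change ((Nat.factorial 0 : 𝕜)⁻¹) * coeff (contract 0 2 (vol 𝕜 (0 + 2)) (one2 𝕜)) ![i, j] = _
  rw [coeff_contract, Fintype.sum_subsingleton _ ![], coeff_one2]
  simp only [Nat.factorial_zero, Nat.cast_one, inv_one, one_mul]
  exact congrArg (coeff (eps 𝕜)) (by funext x; fin_cases x <;> rfl)

theorem star2_eps : star2 𝕜 (eps 𝕜) = one2 𝕜 := by
  refine ext_coeff fun I _ => ?_
  change ((Nat.factorial 2 : 𝕜)⁻¹) * coeff (contract 2 0 (vol 𝕜 (2 + 0)) (eps 𝕜)) I = _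
  rw [coeff_contract, sum_vec_two, coeff_one2]
  have (i j : Fin 2) : coeff (vol 𝕜 (2 + 0)) (Fin.append ![i, j] I) = coeff (eps 𝕜) ![i, j] :=
    congrArg (coeff (eps 𝕜)) (by funext x; fin_cases x <;> rfl)
  simp only [this]
  change ((Nat.factorial 2 : 𝕜)⁻¹) *
    ∑ i : Fin 2, ∑ j : Fin 2, coeff (eps 𝕜) ![i, j] * coeff (eps 𝕜) ![i, j] = 1
  simp only [Fin.sum_univ_two, coeff_eps]
  norm_num [Nat.factorial]

theorem coeff_star1 (ω : Form 𝕜 2 1) (b : Fin 2) :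
    coeff (star1 𝕜 ω) ![b] = ∑ a, coeff ω ![a] * coeff (eps 𝕜) ![a, b] := by
  change ((Nat.factorial 1 : 𝕜)⁻¹) * coeff (contract 1 1 (vol 𝕜 (1 + 1)) ω) ![b] = _
  rw [coeff_contract, sum_vec_one]
  have (i j : Fin 2) : coeff (vol 𝕜 (1 + 1)) (Fin.append ![i] ![j]) = coeff (eps 𝕜) ![i, j] :=
    congrArg (coeff (eps 𝕜)) (by funext x; fin_cases x <;> rfl)
  simp only [this]
  simp

theorem star1_dual2_zero : star1 𝕜 (dual2 𝕜 0) = dual2 𝕜 1 := by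
  refine ext_coeff_one fun b => ?_
  rw [coeff_star1]
  fin_cases b <;> simp [coeff_eps, coeff_dual2]

theorem star1_dual2_one : star1 𝕜 (dual2 𝕜 1) = -dual2 𝕜 0 := by
  refine ext_coeff_one fun b => ?_
  rw [coeff_star1]
  fin_cases b <;> simp [coeff_eps, coeff_dual2]

theorem blockOp_splitOfParts (x : Parts 𝕜) :
    blockOp 𝕜 (splitOfParts x) = splitOfParts (partsOp 𝕜 x) := by
  obtain ⟨F, G, H, K⟩ := x
  change (TensorProduct.map ((6 : 𝕜) • eThetaTilde 𝕜) (star2 𝕜) (K ⊗ₜ eps 𝕜),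
    TensorProduct.map ((3 : 𝕜) • bTheta2 𝕜) (star1 𝕜) (G ⊗ₜ dual2 𝕜 0 + H ⊗ₜ dual2 𝕜 1),
    TensorProduct.map (eTheta 𝕜) (star0 𝕜) (F ⊗ₜ one2 𝕜)) = _
  have hneg : -(((3 : 𝕜) • bTheta2 𝕜) H) = (-3 : 𝕜) • bTheta2 𝕜 H := by
    rw [neg_smul, LinearMap.smul_apply]
  rw [map_add, TensorProduct.map_tmul, TensorProduct.map_tmul, TensorProduct.map_tmul,
    TensorProduct.map_tmul, star0_one2, star2_eps, star1_dual2_one, star1_dual2_zero,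
    TensorProduct.tmul_neg, ← TensorProduct.neg_tmul, hneg, add_comm]
  simp only [splitOfParts, partsOp, LinearMap.smul_apply]

theorem bThetaHat_comp_assemble :
    bThetaHat 𝕜 ∘ₗ assemble 𝕜 = assemble 𝕜 ∘ₗ blockOp 𝕜 := by
  refine LinearMap.ext fun s => ?_
  obtain ⟨x, rfl⟩ := splitOfParts_surjective s
  refine parts_injective ?_
  rw [LinearMap.comp_apply, LinearMap.comp_apply, parts_bThetaHat, blockOp_splitOfParts,
    parts_assemble_splitOfParts, parts_assemble_splitOfParts]

/-! ### Explicit contractions with Θ -/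

/-- The Kronecker delta. -/
def delta (𝕜 : Type*) [RCLike 𝕜] {n : ℕ} (i j : Fin n) : 𝕜 := if i = j then 1 else 0

theorem coeff_basis_two {n : ℕ} (a b x y : Fin n) :
    coeff (basis 𝕜 ![a, b]) ![x, y] = delta 𝕜 a x * delta 𝕜 b y - delta 𝕜 b x * delta 𝕜 a y := by
  rw [coeff_basis, Matrix.det_fin_two]
  rfl

theorem coeff_basis_three {n : ℕ} (a b c x y z : Fin n) :
    coeff (basis 𝕜 ![a, b, c]) ![x, y, z] =
      delta 𝕜 a x * coeff (basis 𝕜 ![b, c]) ![y, z] -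
      delta 𝕜 b x * coeff (basis 𝕜 ![a, c]) ![y, z] +
      delta 𝕜 c x * coeff (basis 𝕜 ![a, b]) ![y, z] := by
  simp only [coeff_basis_two]
  rw [coeff_basis, Matrix.det_fin_three]
  change delta 𝕜 a x * delta 𝕜 b y * delta 𝕜 c z - delta 𝕜 a x * delta 𝕜 c y * delta 𝕜 b z -
    delta 𝕜 b x * delta 𝕜 a y * delta 𝕜 c z + delta 𝕜 b x * delta 𝕜 c y * delta 𝕜 a z +
    delta 𝕜 c x * delta 𝕜 a y * delta 𝕜 b z - delta 𝕜 c x * delta 𝕜 b y * delta 𝕜 a z = _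
  ring

theorem coeff_basis_four {n : ℕ} (a b c d x y z w : Fin n) :
    coeff (basis 𝕜 ![a, b, c, d]) ![x, y, z, w] =
      delta 𝕜 a x * coeff (basis 𝕜 ![b, c, d]) ![y, z, w] -
      delta 𝕜 b x * coeff (basis 𝕜 ![a, c, d]) ![y, z, w] +
      delta 𝕜 c x * coeff (basis 𝕜 ![a, b, d]) ![y, z, w] -
      delta 𝕜 d x * coeff (basis 𝕜 ![a, b, c]) ![y, z, w] := by
  simp only [coeff_basis]
  rw [Matrix.det_succ_row_zero]
  simp only [Fin.sum_univ_four]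
  have e0 : ![a, b, c, d] ∘ Fin.succAbove 0 = ![b, c, d] := by
    funext t; fin_cases t <;> rfl
  have e1 : ![a, b, c, d] ∘ Fin.succAbove 1 = ![a, c, d] := by
    funext t; fin_cases t <;> rfl
  have e2 : ![a, b, c, d] ∘ Fin.succAbove 2 = ![a, b, d] := by
    funext t; fin_cases t <;> rfl
  have e3 : ![a, b, c, d] ∘ Fin.succAbove 3 = ![a, b, c] := by
    funext t; fin_cases t <;> rfl
  have hsub (f g : Fin 4 → Fin n) (s : Fin 4) :
      (Matrix.of fun i j => if f j = g i then (1 : 𝕜) else 0).submatrix Fin.succ s.succAbove =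
      Matrix.of fun i j => if (f ∘ s.succAbove) j = (g ∘ Fin.succ) i then (1 : 𝕜) else 0 := rfl
  have eg : ![x, y, z, w] ∘ Fin.succ = ![y, z, w] := by
    funext t; fin_cases t <;> rfl
  rw [hsub, hsub, hsub, hsub, e0, e1, e2, e3, eg]
  change (-1 : 𝕜) ^ 0 * delta 𝕜 a x * _ + (-1 : 𝕜) ^ 1 * delta 𝕜 b x * _ +
    (-1 : 𝕜) ^ 2 * delta 𝕜 c x * _ + (-1 : 𝕜) ^ 3 * delta 𝕜 d x * _ = _
  ring

/-- `Θ_{ijkl} G^{ij}` for a decomposable `Θ` and antisymmetric `G`. -/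
theorem sum_coeff_basis_two_two {n : ℕ} (g : Fin n → Fin n → 𝕜) (hg : ∀ i j, g j i = -g i j)
    (a b c d l m : Fin n) :
    ∑ i, ∑ j, g i j * coeff (basis 𝕜 ![a, b, c, d]) ![i, j, l, m] =
      2 * (g a b * coeff (basis 𝕜 ![c, d]) ![l, m] - g a c * coeff (basis 𝕜 ![b, d]) ![l, m] +
        g a d * coeff (basis 𝕜 ![b, c]) ![l, m] + g b c * coeff (basis 𝕜 ![a, d]) ![l, m] -
        g b d * coeff (basis 𝕜 ![a, c]) ![l, m] + g c d * coeff (basis 𝕜 ![a, b]) ![l, m]) := by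
  have key (p q : Fin n) (r : 𝕜) :
      ∑ i, ∑ j, g i j * (delta 𝕜 p i * (delta 𝕜 q j * r)) = g p q * r := by
    simp [delta]
  simp only [coeff_basis_four, coeff_basis_three, mul_add, mul_sub, Finset.sum_add_distrib,
    Finset.sum_sub_distrib, key]
  rw [hg a b, hg a c, hg a d, hg b c, hg b d, hg c d]
  ring

theorem sum_coeff_basis_one_three {n : ℕ} (g : Fin n → 𝕜) (a b c d l m k : Fin n) :
    ∑ i, g i * coeff (basis 𝕜 ![a, b, c, d]) ![i, l, m, k] =
      g a * coeff (basis 𝕜 ![b, c, d]) ![l, m, k] - g b * coeff (basis 𝕜 ![a, c, d]) ![l, m, k] +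
        g c * coeff (basis 𝕜 ![a, b, d]) ![l, m, k] -
        g d * coeff (basis 𝕜 ![a, b, c]) ![l, m, k] := by
  have key (p : Fin n) (r : 𝕜) : ∑ i, g i * (delta 𝕜 p i * r) = g p * r := by
    simp [delta]
  simp only [coeff_basis_four, mul_add, mul_sub, Finset.sum_add_distrib,
    Finset.sum_sub_distrib, key]

theorem sum_coeff_basis_three_one {n : ℕ} (g : Fin n → Fin n → Fin n → 𝕜)
    (h₁ : ∀ i j k, g j i k = -g i j k) (h₂ : ∀ i j k, g i k j = -g i j k) (a b c d l : Fin n) :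
    ∑ i, ∑ j, ∑ k, g i j k * coeff (basis 𝕜 ![a, b, c, d]) ![i, j, k, l] =
      6 * (g a b c * delta 𝕜 d l - g a b d * delta 𝕜 c l + g a c d * delta 𝕜 b l -
        g b c d * delta 𝕜 a l) := by
  have key (p q s : Fin n) (r : 𝕜) :
      ∑ i, ∑ j, ∑ k, g i j k * (delta 𝕜 p i * (delta 𝕜 q j * (delta 𝕜 s k * r))) =
        g p q s * r := by
    simp [delta]
  simp only [coeff_basis_four, coeff_basis_three, coeff_basis_two, mul_add, mul_sub,
    Finset.sum_add_distrib, Finset.sum_sub_distrib, key]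
  have perm (p q s : Fin n) : g q p s = -g p q s ∧ g p s q = -g p q s ∧ g q s p = g p q s ∧
      g s p q = g p q s ∧ g s q p = -g p q s := by
    refine ⟨h₁ _ _ _, h₂ _ _ _, ?_, ?_, ?_⟩
    · rw [h₂ q p s, h₁ p q s, neg_neg]
    · rw [h₁ p s q, h₂ p q s, neg_neg]
    · rw [h₁ q s p, h₂ q p s, h₁ p q s, neg_neg]
  obtain ⟨p1, p2, p3, p4, p5⟩ := perm a b c
  obtain ⟨q1, q2, q3, q4, q5⟩ := perm a b d
  obtain ⟨r1, r2, r3, r4, r5⟩ := perm a c d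
  obtain ⟨s1, s2, s3, s4, s5⟩ := perm b c d
  rw [p1, p2, p3, p4, p5, q1, q2, q3, q4, q5, r1, r2, r3, r4, r5, s1, s2, s3, s4, s5]
  ring

/-- For increasing indices the determinant collapses to a single decidable condition, which keeps
the component tables computable by `simp`. This is why Θ is rewritten with sorted indices in
`Theta_eq`. -/
theorem coeff_basis_two_of_lt {n : ℕ} {a b x y : Fin n} (hab : a < b) (hxy : x < y) :
    coeff (basis 𝕜 ![a, b]) ![x, y] = if a = x ∧ b = y then 1 else 0 := by
  have h (f : Fin 2 → Fin n) (hf : f 0 < f 1) : StrictMono f := by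
    rw [Fin.strictMono_iff_lt_succ]
    intro i
    fin_cases i
    exact hf
  have := coeff_basis_orderEmb (𝕜 := 𝕜) (OrderEmbedding.ofStrictMono ![a, b] (h _ hab))
    (OrderEmbedding.ofStrictMono ![x, y] (h _ hxy))
  refine this.trans ?_
  congr 1
  rw [eq_iff_iff, ← DFunLike.coe_injective.eq_iff]
  simp

theorem coeff_basis_three_of_lt {n : ℕ} {a b c x y z : Fin n} (hab : a < b) (hbc : b < c)
    (hxy : x < y) (hyz : y < z) :
    coeff (basis 𝕜 ![a, b, c]) ![x, y, z] = if a = x ∧ b = y ∧ c = z then 1 else 0 := by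
  have h (f : Fin 3 → Fin n) (hf : f 0 < f 1) (hf' : f 1 < f 2) : StrictMono f := by
    rw [Fin.strictMono_iff_lt_succ]
    intro i
    fin_cases i
    · exact hf
    · exact hf'
  have := coeff_basis_orderEmb (𝕜 := 𝕜) (OrderEmbedding.ofStrictMono ![a, b, c] (h _ hab hbc))
    (OrderEmbedding.ofStrictMono ![x, y, z] (h _ hxy hyz))
  refine this.trans ?_
  congr 1
  rw [eq_iff_iff, ← DFunLike.coe_injective.eq_iff]
  simp

theorem basis_comp_perm {n k : ℕ} (I : Fin k → Fin n) (σ : Equiv.Perm (Fin k)) :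
    basis 𝕜 (I ∘ σ) = ((Equiv.Perm.sign σ : ℤ) : 𝕜) • basis 𝕜 I := by
  refine ext_coeff fun J _ => ?_
  rw [coeff_smul, coeff_basis, coeff_basis]
  exact Matrix.det_permute' σ (Matrix.of fun a b => if I b = J a then (1 : 𝕜) else 0)

theorem basis_swap01 {n : ℕ} (a b c d : Fin n) :
    basis 𝕜 ![b, a, c, d] = -basis 𝕜 ![a, b, c, d] := by
  have h := basis_comp_perm (𝕜 := 𝕜) ![a, b, c, d] (Equiv.swap 0 1)
  rw [Equiv.Perm.sign_swap (by decide)] at h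
  rw [show ![b, a, c, d] = ![a, b, c, d] ∘ Equiv.swap 0 1 by
    funext x; fin_cases x <;> rfl, h]
  simp

theorem basis_swap12 {n : ℕ} (a b c d : Fin n) :
    basis 𝕜 ![a, c, b, d] = -basis 𝕜 ![a, b, c, d] := by
  have h := basis_comp_perm (𝕜 := 𝕜) ![a, b, c, d] (Equiv.swap 1 2)
  rw [Equiv.Perm.sign_swap (by decide)] at h
  rw [show ![a, c, b, d] = ![a, b, c, d] ∘ Equiv.swap 1 2 by
    funext x; fin_cases x <;> rfl, h]
  simp

theorem basis_swap23 {n : ℕ} (a b c d : Fin n) :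
    basis 𝕜 ![a, b, d, c] = -basis 𝕜 ![a, b, c, d] := by
  have h := basis_comp_perm (𝕜 := 𝕜) ![a, b, c, d] (Equiv.swap 2 3)
  rw [Equiv.Perm.sign_swap (by decide)] at h
  rw [show ![a, b, d, c] = ![a, b, c, d] ∘ Equiv.swap 2 3 by
    funext x; fin_cases x <;> rfl, h]
  simp

/-- `Θ` in terms of the forms `e_i ∧ e_j ∧ e_k ∧ e_l` with `i < j < k < l`. -/
theorem Theta_eq : Theta 𝕜 =
    basis 𝕜 ![0, 1, 3, 4] - basis 𝕜 ![0, 1, 5, 6] + basis 𝕜 ![0, 2, 3, 5] +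
    basis 𝕜 ![0, 2, 4, 6] + basis 𝕜 ![1, 2, 4, 5] - basis 𝕜 ![1, 2, 3, 6] +
    basis 𝕜 ![3, 4, 5, 6] + basis 𝕜 ![0, 1, 2, 7] - basis 𝕜 ![2, 3, 4, 7] +
    basis 𝕜 ![0, 3, 6, 7] - basis 𝕜 ![0, 4, 5, 7] + basis 𝕜 ![1, 4, 6, 7] +
    basis 𝕜 ![1, 3, 5, 7] + basis 𝕜 ![2, 5, 6, 7] := by
  rw [Theta, basis_swap23 0 1 5 6, basis_swap12 1 2 3 6, basis_swap01 2 3 4 7,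
    basis_swap12 3 0 6 7, basis_swap01 0 3 6 7, basis_swap01 0 4 5 7,
    basis_swap12 4 1 6 7, basis_swap01 1 4 6 7, basis_swap01 1 5 3 7, basis_swap12 1 3 5 7,
    basis_swap12 5 2 6 7, basis_swap01 2 5 6 7]
  simp only [neg_neg, sub_eq_add_neg]

/-- `½ g^{ij} (e_a ∧ e_b ∧ e_c ∧ e_d)_{ijlm}` for antisymmetric `g`, `a < b < c < d` and `l < m`. -/
def pairTerm {n : ℕ} (g : Fin n → Fin n → 𝕜) (a b c d l m : Fin n) : 𝕜 :=
  (g a b * if c = l ∧ d = m then 1 else 0) - (g a c * if b = l ∧ d = m then 1 else 0) +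
  (g a d * if b = l ∧ c = m then 1 else 0) + (g b c * if a = l ∧ d = m then 1 else 0) -
  (g b d * if a = l ∧ c = m then 1 else 0) + (g c d * if a = l ∧ b = m then 1 else 0)

theorem sum_coeff_basis_eq_pairTerm {n : ℕ} (g : Fin n → Fin n → 𝕜) (hg : ∀ i j, g j i = -g i j)
    {a b c d l m : Fin n} (hab : a < b) (hbc : b < c) (hcd : c < d) (hlm : l < m) :
    ∑ i, ∑ j, g i j * coeff (basis 𝕜 ![a, b, c, d]) ![i, j, l, m] =
      2 * pairTerm g a b c d l m := by
  rw [sum_coeff_basis_two_two g hg, pairTerm, coeff_basis_two_of_lt hcd hlm,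
    coeff_basis_two_of_lt (hbc.trans hcd) hlm, coeff_basis_two_of_lt hbc hlm,
    coeff_basis_two_of_lt (hab.trans (hbc.trans hcd)) hlm,
    coeff_basis_two_of_lt (hab.trans hbc) hlm, coeff_basis_two_of_lt hab hlm]

/-- `g^i (e_a ∧ e_b ∧ e_c ∧ e_d)_{ilmk}` for `a < b < c < d` and `l < m < k`. -/
def oneTerm {n : ℕ} (g : Fin n → 𝕜) (a b c d l m k : Fin n) : 𝕜 :=
  (g a * if b = l ∧ c = m ∧ d = k then 1 else 0) -
  (g b * if a = l ∧ c = m ∧ d = k then 1 else 0) +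
  (g c * if a = l ∧ b = m ∧ d = k then 1 else 0) -
  (g d * if a = l ∧ b = m ∧ c = k then 1 else 0)

theorem sum_coeff_basis_eq_oneTerm {n : ℕ} (g : Fin n → 𝕜) {a b c d l m k : Fin n} (hab : a < b)
    (hbc : b < c) (hcd : c < d) (hlm : l < m) (hmk : m < k) :
    ∑ i, g i * coeff (basis 𝕜 ![a, b, c, d]) ![i, l, m, k] = oneTerm g a b c d l m k := by
  rw [sum_coeff_basis_one_three g, oneTerm, coeff_basis_three_of_lt hbc hcd hlm hmk,
    coeff_basis_three_of_lt (hab.trans hbc) hcd hlm hmk,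
    coeff_basis_three_of_lt hab (hbc.trans hcd) hlm hmk, coeff_basis_three_of_lt hab hbc hlm hmk]

/-- `Θ_{ijlm} g^{ij}`. -/
def pairSum (g : Fin 8 → Fin 8 → 𝕜) (l m : Fin 8) : 𝕜 :=
  ∑ i, ∑ j, g i j * coeff (Theta 𝕜) ![i, j, l, m]

theorem pairSum_eq_pairTerm (g : Fin 8 → Fin 8 → 𝕜) (hg : ∀ i j, g j i = -g i j)
    {l m : Fin 8} (hlm : l < m) :
    pairSum g l m = 2 * (pairTerm g 0 1 3 4 l m - pairTerm g 0 1 5 6 l m + pairTerm g 0 2 3 5 l m +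
        pairTerm g 0 2 4 6 l m + pairTerm g 1 2 4 5 l m - pairTerm g 1 2 3 6 l m +
        pairTerm g 3 4 5 6 l m + pairTerm g 0 1 2 7 l m - pairTerm g 2 3 4 7 l m +
        pairTerm g 0 3 6 7 l m - pairTerm g 0 4 5 7 l m + pairTerm g 1 4 6 7 l m +
        pairTerm g 1 3 5 7 l m + pairTerm g 2 5 6 7 l m) := by
  simp (disch := first | assumption | decide) only [pairSum, Theta_eq, coeff_add, coeff_sub,
    mul_add, mul_sub, Finset.sum_add_distrib, Finset.sum_sub_distrib, sum_coeff_basis_eq_pairTerm]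

/-- Each pair of indices lies in exactly three of the fourteen quadruples of Θ, hence three terms
per row; the 2 counts the orders of the contracted pair. -/
theorem pairSum_apply (g : Fin 8 → Fin 8 → 𝕜) (hg : ∀ i j, g j i = -g i j) :
    pairSum g 0 1 = 2 * (g 3 4 - g 5 6 + g 2 7) ∧
    pairSum g 0 2 = 2 * (g 3 5 + g 4 6 - g 1 7) ∧
    pairSum g 0 3 = 2 * (-g 1 4 - g 2 5 + g 6 7) ∧
    pairSum g 0 4 = 2 * (g 1 3 - g 2 6 - g 5 7) ∧
    pairSum g 0 5 = 2 * (g 1 6 + g 2 3 + g 4 7) ∧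
    pairSum g 0 6 = 2 * (-g 1 5 + g 2 4 - g 3 7) ∧
    pairSum g 0 7 = 2 * (g 1 2 + g 3 6 - g 4 5) ∧
    pairSum g 1 2 = 2 * (g 4 5 - g 3 6 + g 0 7) ∧
    pairSum g 1 3 = 2 * (g 0 4 + g 2 6 + g 5 7) ∧
    pairSum g 1 4 = 2 * (-g 0 3 - g 2 5 + g 6 7) ∧
    pairSum g 1 5 = 2 * (-g 0 6 + g 2 4 - g 3 7) ∧
    pairSum g 1 6 = 2 * (g 0 5 - g 2 3 - g 4 7) ∧
    pairSum g 1 7 = 2 * (-g 0 2 + g 4 6 + g 3 5) ∧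
    pairSum g 2 3 = 2 * (g 0 5 - g 1 6 - g 4 7) ∧
    pairSum g 2 4 = 2 * (g 0 6 + g 1 5 + g 3 7) ∧
    pairSum g 2 5 = 2 * (-g 0 3 - g 1 4 + g 6 7) ∧
    pairSum g 2 6 = 2 * (-g 0 4 + g 1 3 - g 5 7) ∧
    pairSum g 2 7 = 2 * (g 0 1 - g 3 4 + g 5 6) ∧
    pairSum g 3 4 = 2 * (g 0 1 + g 5 6 - g 2 7) ∧
    pairSum g 3 5 = 2 * (g 0 2 - g 4 6 + g 1 7) ∧
    pairSum g 3 6 = 2 * (-g 1 2 + g 4 5 + g 0 7) ∧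
    pairSum g 3 7 = 2 * (g 2 4 - g 0 6 - g 1 5) ∧
    pairSum g 4 5 = 2 * (g 1 2 + g 3 6 - g 0 7) ∧
    pairSum g 4 6 = 2 * (g 0 2 - g 3 5 + g 1 7) ∧
    pairSum g 4 7 = 2 * (-g 2 3 + g 0 5 - g 1 6) ∧
    pairSum g 5 6 = 2 * (-g 0 1 + g 3 4 + g 2 7) ∧
    pairSum g 5 7 = 2 * (-g 0 4 + g 1 3 - g 2 6) ∧
    pairSum g 6 7 = 2 * (g 0 3 + g 1 4 + g 2 5) := by
  and_intros
  all_goals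
    rw [pairSum_eq_pairTerm g hg (by decide)]
    congr 1
    simp [pairTerm] <;> ring

theorem sum_mul_coeff_Theta_one (g : Fin 8 → 𝕜) {l m k : Fin 8} (hlm : l < m) (hmk : m < k) :
    ∑ i, g i * coeff (Theta 𝕜) ![i, l, m, k] = oneTerm g 0 1 3 4 l m k - oneTerm g 0 1 5 6 l m k +
      oneTerm g 0 2 3 5 l m k +
      oneTerm g 0 2 4 6 l m k + oneTerm g 1 2 4 5 l m k - oneTerm g 1 2 3 6 l m k +
      oneTerm g 3 4 5 6 l m k + oneTerm g 0 1 2 7 l m k - oneTerm g 2 3 4 7 l m k +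
      oneTerm g 0 3 6 7 l m k - oneTerm g 0 4 5 7 l m k + oneTerm g 1 4 6 7 l m k +
      oneTerm g 1 3 5 7 l m k + oneTerm g 2 5 6 7 l m k := by
  simp (disch := first | assumption | decide) only [Theta_eq, coeff_add, coeff_sub, mul_add,
    mul_sub, Finset.sum_add_distrib, Finset.sum_sub_distrib, sum_coeff_basis_eq_oneTerm]

/-- Each index lies in exactly seven of the fourteen quadruples, hence seven terms per row; the 6
counts the orders of the contracted triple. -/
theorem sum_mul_coeff_Theta_three (g : Fin 8 → Fin 8 → Fin 8 → 𝕜)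
    (h₁ : ∀ i j k, g j i k = -g i j k) (h₂ : ∀ i j k, g i k j = -g i j k) :
    (∑ i, ∑ j, ∑ k, g i j k * coeff (Theta 𝕜) ![i, j, k, 0]) = 6 * (-g 1 3 4 + g 1 5 6 - g 2 3 5
      - g 2 4 6 - g 1 2 7 - g 3 6 7 + g 4 5 7) ∧
    (∑ i, ∑ j, ∑ k, g i j k * coeff (Theta 𝕜) ![i, j, k, 1]) = 6 * (g 0 3 4 - g 0 5 6 - g 2 4 5
      + g 2 3 6 + g 0 2 7 - g 4 6 7 - g 3 5 7) ∧
    (∑ i, ∑ j, ∑ k, g i j k * coeff (Theta 𝕜) ![i, j, k, 2]) = 6 * (g 0 3 5 + g 0 4 6 + g 1 4 5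
      - g 1 3 6 - g 0 1 7 + g 3 4 7 - g 5 6 7) ∧
    (∑ i, ∑ j, ∑ k, g i j k * coeff (Theta 𝕜) ![i, j, k, 3]) = 6 * (-g 0 1 4 - g 0 2 5 + g 1 2 6
      - g 4 5 6 - g 2 4 7 + g 0 6 7 + g 1 5 7) ∧
    (∑ i, ∑ j, ∑ k, g i j k * coeff (Theta 𝕜) ![i, j, k, 4]) = 6 * (g 0 1 3 - g 0 2 6 - g 1 2 5
      + g 3 5 6 + g 2 3 7 - g 0 5 7 + g 1 6 7) ∧
    (∑ i, ∑ j, ∑ k, g i j k * coeff (Theta 𝕜) ![i, j, k, 5]) = 6 * (g 0 1 6 + g 0 2 3 + g 1 2 4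
      - g 3 4 6 + g 0 4 7 - g 1 3 7 + g 2 6 7) ∧
    (∑ i, ∑ j, ∑ k, g i j k * coeff (Theta 𝕜) ![i, j, k, 6]) = 6 * (-g 0 1 5 + g 0 2 4 - g 1 2 3
      + g 3 4 5 - g 0 3 7 - g 1 4 7 - g 2 5 7) ∧
    (∑ i, ∑ j, ∑ k, g i j k * coeff (Theta 𝕜) ![i, j, k, 7]) = 6 * (g 0 1 2 - g 2 3 4 + g 0 3 6
      - g 0 4 5 + g 1 4 6 + g 1 3 5 + g 2 5 6) := by
  and_intros
  all_goals
    simp only [Theta_eq, coeff_add, coeff_sub, mul_add, mul_sub, Finset.sum_add_distrib,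
      Finset.sum_sub_distrib, sum_coeff_basis_three_one g h₁ h₂]
    simp [delta] <;> ring

theorem coeff_bTheta2_eq_pairSum (G : Form 𝕜 8 2) (l m : Fin 8) :
    coeff (bTheta2 𝕜 G) ![l, m] = pairSum (fun i j => coeff G ![i, j]) l m :=
  coeff_bTheta2 G l m

theorem coeff_bTheta2_apply (G : Form 𝕜 8 2) :
    coeff (bTheta2 𝕜 G) ![0, 1] =
      2 * (coeff G ![3, 4] - coeff G ![5, 6] + coeff G ![2, 7]) ∧
    coeff (bTheta2 𝕜 G) ![0, 2] =
      2 * (coeff G ![3, 5] + coeff G ![4, 6] - coeff G ![1, 7]) ∧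
    coeff (bTheta2 𝕜 G) ![0, 3] =
      2 * (-coeff G ![1, 4] - coeff G ![2, 5] + coeff G ![6, 7]) ∧
    coeff (bTheta2 𝕜 G) ![0, 4] =
      2 * (coeff G ![1, 3] - coeff G ![2, 6] - coeff G ![5, 7]) ∧
    coeff (bTheta2 𝕜 G) ![0, 5] =
      2 * (coeff G ![1, 6] + coeff G ![2, 3] + coeff G ![4, 7]) ∧
    coeff (bTheta2 𝕜 G) ![0, 6] =
      2 * (-coeff G ![1, 5] + coeff G ![2, 4] - coeff G ![3, 7]) ∧
    coeff (bTheta2 𝕜 G) ![0, 7] =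
      2 * (coeff G ![1, 2] + coeff G ![3, 6] - coeff G ![4, 5]) ∧
    coeff (bTheta2 𝕜 G) ![1, 2] =
      2 * (coeff G ![4, 5] - coeff G ![3, 6] + coeff G ![0, 7]) ∧
    coeff (bTheta2 𝕜 G) ![1, 3] =
      2 * (coeff G ![0, 4] + coeff G ![2, 6] + coeff G ![5, 7]) ∧
    coeff (bTheta2 𝕜 G) ![1, 4] =
      2 * (-coeff G ![0, 3] - coeff G ![2, 5] + coeff G ![6, 7]) ∧
    coeff (bTheta2 𝕜 G) ![1, 5] =
      2 * (-coeff G ![0, 6] + coeff G ![2, 4] - coeff G ![3, 7]) ∧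
    coeff (bTheta2 𝕜 G) ![1, 6] =
      2 * (coeff G ![0, 5] - coeff G ![2, 3] - coeff G ![4, 7]) ∧
    coeff (bTheta2 𝕜 G) ![1, 7] =
      2 * (-coeff G ![0, 2] + coeff G ![4, 6] + coeff G ![3, 5]) ∧
    coeff (bTheta2 𝕜 G) ![2, 3] =
      2 * (coeff G ![0, 5] - coeff G ![1, 6] - coeff G ![4, 7]) ∧
    coeff (bTheta2 𝕜 G) ![2, 4] =
      2 * (coeff G ![0, 6] + coeff G ![1, 5] + coeff G ![3, 7]) ∧
    coeff (bTheta2 𝕜 G) ![2, 5] =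
      2 * (-coeff G ![0, 3] - coeff G ![1, 4] + coeff G ![6, 7]) ∧
    coeff (bTheta2 𝕜 G) ![2, 6] =
      2 * (-coeff G ![0, 4] + coeff G ![1, 3] - coeff G ![5, 7]) ∧
    coeff (bTheta2 𝕜 G) ![2, 7] =
      2 * (coeff G ![0, 1] - coeff G ![3, 4] + coeff G ![5, 6]) ∧
    coeff (bTheta2 𝕜 G) ![3, 4] =
      2 * (coeff G ![0, 1] + coeff G ![5, 6] - coeff G ![2, 7]) ∧
    coeff (bTheta2 𝕜 G) ![3, 5] =
      2 * (coeff G ![0, 2] - coeff G ![4, 6] + coeff G ![1, 7]) ∧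
    coeff (bTheta2 𝕜 G) ![3, 6] =
      2 * (-coeff G ![1, 2] + coeff G ![4, 5] + coeff G ![0, 7]) ∧
    coeff (bTheta2 𝕜 G) ![3, 7] =
      2 * (coeff G ![2, 4] - coeff G ![0, 6] - coeff G ![1, 5]) ∧
    coeff (bTheta2 𝕜 G) ![4, 5] =
      2 * (coeff G ![1, 2] + coeff G ![3, 6] - coeff G ![0, 7]) ∧
    coeff (bTheta2 𝕜 G) ![4, 6] =
      2 * (coeff G ![0, 2] - coeff G ![3, 5] + coeff G ![1, 7]) ∧
    coeff (bTheta2 𝕜 G) ![4, 7] =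
      2 * (-coeff G ![2, 3] + coeff G ![0, 5] - coeff G ![1, 6]) ∧
    coeff (bTheta2 𝕜 G) ![5, 6] =
      2 * (-coeff G ![0, 1] + coeff G ![3, 4] + coeff G ![2, 7]) ∧
    coeff (bTheta2 𝕜 G) ![5, 7] =
      2 * (-coeff G ![0, 4] + coeff G ![1, 3] - coeff G ![2, 6]) ∧
    coeff (bTheta2 𝕜 G) ![6, 7] =
      2 * (coeff G ![0, 3] + coeff G ![1, 4] + coeff G ![2, 5]) := by
  simp only [coeff_bTheta2_eq_pairSum]
  exact pairSum_apply _ fun i j => coeff_swap G i j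

theorem coeff_eTheta_apply (F : Form 𝕜 8 3) :
    coeff (eTheta 𝕜 F) ![0] = 6 * (-coeff F ![1, 3, 4] + coeff F ![1, 5, 6] - coeff F ![2, 3, 5]
      - coeff F ![2, 4, 6] - coeff F ![1, 2, 7] - coeff F ![3, 6, 7] + coeff F ![4, 5, 7]) ∧
    coeff (eTheta 𝕜 F) ![1] = 6 * (coeff F ![0, 3, 4] - coeff F ![0, 5, 6] - coeff F ![2, 4, 5]
      + coeff F ![2, 3, 6] + coeff F ![0, 2, 7] - coeff F ![4, 6, 7] - coeff F ![3, 5, 7]) ∧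
    coeff (eTheta 𝕜 F) ![2] = 6 * (coeff F ![0, 3, 5] + coeff F ![0, 4, 6] + coeff F ![1, 4, 5]
      - coeff F ![1, 3, 6] - coeff F ![0, 1, 7] + coeff F ![3, 4, 7] - coeff F ![5, 6, 7]) ∧
    coeff (eTheta 𝕜 F) ![3] = 6 * (-coeff F ![0, 1, 4] - coeff F ![0, 2, 5] + coeff F ![1, 2, 6]
      - coeff F ![4, 5, 6] - coeff F ![2, 4, 7] + coeff F ![0, 6, 7] + coeff F ![1, 5, 7]) ∧
    coeff (eTheta 𝕜 F) ![4] = 6 * (coeff F ![0, 1, 3] - coeff F ![0, 2, 6] - coeff F ![1, 2, 5]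
      + coeff F ![3, 5, 6] + coeff F ![2, 3, 7] - coeff F ![0, 5, 7] + coeff F ![1, 6, 7]) ∧
    coeff (eTheta 𝕜 F) ![5] = 6 * (coeff F ![0, 1, 6] + coeff F ![0, 2, 3] + coeff F ![1, 2, 4]
      - coeff F ![3, 4, 6] + coeff F ![0, 4, 7] - coeff F ![1, 3, 7] + coeff F ![2, 6, 7]) ∧
    coeff (eTheta 𝕜 F) ![6] = 6 * (-coeff F ![0, 1, 5] + coeff F ![0, 2, 4] - coeff F ![1, 2, 3]
      + coeff F ![3, 4, 5] - coeff F ![0, 3, 7] - coeff F ![1, 4, 7] - coeff F ![2, 5, 7]) ∧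
    coeff (eTheta 𝕜 F) ![7] = 6 * (coeff F ![0, 1, 2] - coeff F ![2, 3, 4] + coeff F ![0, 3, 6]
      - coeff F ![0, 4, 5] + coeff F ![1, 4, 6] + coeff F ![1, 3, 5] + coeff F ![2, 5, 6]) := by
  simp only [coeff_eTheta]
  exact sum_mul_coeff_Theta_three _ (fun i j k => coeff_swap01 F i j k)
    (fun i j k => coeff_swap12 F i j k)

/-! ### Algebraic identities for b_Θ, e_Θ and ẽ_Θ -/

/-- In other words (b - 2)(b + 6) = 0, checked on all 28 components with the table of b. -/
theorem bTheta2_sq (G : Form 𝕜 8 2) :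
    bTheta2 𝕜 (bTheta2 𝕜 G) = (12 : 𝕜) • G - (4 : 𝕜) • bTheta2 𝕜 G := by
  refine ext_coeff_two fun l m hlm => ?_
  rw [coeff_sub, coeff_smul, coeff_smul]
  fin_cases l <;> fin_cases m <;> first | exact absurd hlm (by decide) | clear hlm
  all_goals
    simp only [Fin.zero_eta, Fin.mk_one, Fin.reduceFinMk, coeff_bTheta2_apply]
    ring

theorem coeff_eThetaTilde_of_lt (K : Form 𝕜 8 1) {l m k : Fin 8} (hlm : l < m) (hmk : m < k) :
    coeff (eThetaTilde 𝕜 K) ![l, m, k] = oneTerm (fun i => coeff K ![i]) 0 1 3 4 l m k -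
      oneTerm (fun i => coeff K ![i]) 0 1 5 6 l m k +
      oneTerm (fun i => coeff K ![i]) 0 2 3 5 l m k +
      oneTerm (fun i => coeff K ![i]) 0 2 4 6 l m k +
      oneTerm (fun i => coeff K ![i]) 1 2 4 5 l m k -
      oneTerm (fun i => coeff K ![i]) 1 2 3 6 l m k +
      oneTerm (fun i => coeff K ![i]) 3 4 5 6 l m k +
      oneTerm (fun i => coeff K ![i]) 0 1 2 7 l m k -
      oneTerm (fun i => coeff K ![i]) 2 3 4 7 l m k +
      oneTerm (fun i => coeff K ![i]) 0 3 6 7 l m k -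
      oneTerm (fun i => coeff K ![i]) 0 4 5 7 l m k +
      oneTerm (fun i => coeff K ![i]) 1 4 6 7 l m k +
      oneTerm (fun i => coeff K ![i]) 1 3 5 7 l m k +
      oneTerm (fun i => coeff K ![i]) 2 5 6 7 l m k := by
  rw [coeff_eThetaTilde]
  exact sum_mul_coeff_Theta_one (fun i => coeff K ![i]) hlm hmk

/-- The composite contracts Θ with itself over three indices, which gives 42 = 7 · 3! on the
diagonal. The sign comes from the odd cyclic permutation taking the index contracted with K from
first to last place. -/
theorem eTheta_eThetaTilde (K : Form 𝕜 8 1) :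
    eTheta 𝕜 (eThetaTilde 𝕜 K) = (-42 : 𝕜) • K := by
  refine ext_coeff_one fun l => ?_
  rw [coeff_smul]
  fin_cases l
  all_goals
    simp only [Fin.zero_eta, Fin.mk_one, Fin.reduceFinMk, coeff_eTheta_apply]
    simp (disch := decide) only [coeff_eThetaTilde_of_lt]
    simp [oneTerm]
    ring

theorem sum_perm_three (f : Equiv.Perm (Fin 3) → 𝕜) :
    ∑ σ, f σ = f 1 + f (Equiv.swap 0 1) + f (Equiv.swap 0 2) + f (Equiv.swap 1 2) +
      f (Equiv.swap 0 1 * Equiv.swap 1 2) + f (Equiv.swap 1 2 * Equiv.swap 0 1) := by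
  rw [show (Finset.univ : Finset (Equiv.Perm (Fin 3))) =
    {1, Equiv.swap 0 1, Equiv.swap 0 2, Equiv.swap 1 2, Equiv.swap 0 1 * Equiv.swap 1 2,
      Equiv.swap 1 2 * Equiv.swap 0 1} by decide]
  rw [Finset.sum_insert (by decide), Finset.sum_insert (by decide), Finset.sum_insert (by decide),
    Finset.sum_insert (by decide), Finset.sum_insert (by decide), Finset.sum_singleton]
  ring

/-- The six permutations agree in pairs because α is antisymmetric, so 1/6 becomes 1/3. -/
theorem coeff_antisymm_two_one {n : ℕ} (α : Form 𝕜 n 2) (β : Form 𝕜 n 1) (x y z : Fin n) :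
    coeff (antisymm α β) ![x, y, z] =
      3⁻¹ * (coeff α ![x, y] * coeff β ![z] + coeff α ![y, z] * coeff β ![x] -
        coeff α ![x, z] * coeff β ![y]) := by
  change ((Nat.factorial 3 : 𝕜)⁻¹) * coeff (altTensor α β) ![x, y, z] = _
  have h := coeff_altTensor α β ![x, y, z]
  have hs := sum_perm_three fun σ => ((Equiv.Perm.sign σ : ℤ) : 𝕜) *
    (coeff α ![![x, y, z] (σ 0), ![x, y, z] (σ 1)] * coeff β ![![x, y, z] (σ 2)])
  have h2 : coeff (altTensor α β) ![x, y, z] = _ := h.trans (Eq.trans (by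
    refine Finset.sum_congr rfl fun σ _ => ?_
    congr 2
    · congr 1; funext t; fin_cases t <;> rfl
    · congr 1; funext t; fin_cases t; rfl) hs)
  rw [h2]
  have s01 : Equiv.Perm.sign (Equiv.swap (0 : Fin 3) 1) = -1 := by decide
  have s02 : Equiv.Perm.sign (Equiv.swap (0 : Fin 3) 2) = -1 := by decide
  have s12 : Equiv.Perm.sign (Equiv.swap (1 : Fin 3) 2) = -1 := by decide
  have s3 : Equiv.Perm.sign (Equiv.swap (0 : Fin 3) 1 * Equiv.swap 1 2) = 1 := by decide
  have s4 : Equiv.Perm.sign (Equiv.swap (1 : Fin 3) 2 * Equiv.swap 0 1) = 1 := by decide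
  rw [s01, s02, s12, s3, s4, Equiv.Perm.sign_one]
  have h01 : Equiv.swap (0 : Fin 3) 1 2 = 2 := by decide
  have h02 : Equiv.swap (0 : Fin 3) 2 1 = 1 := by decide
  have h12 : Equiv.swap (1 : Fin 3) 2 0 = 0 := by decide
  simp only [Units.val_neg, Units.val_one, Int.cast_neg, Int.cast_one, Equiv.Perm.coe_one, id_eq,
    Equiv.Perm.coe_mul, Function.comp_apply, Equiv.swap_apply_left, Equiv.swap_apply_right, h01,
    h02, h12, Matrix.cons_val]
  rw [coeff_swap α x y, coeff_swap α y z, coeff_swap α x z]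
  norm_num [Nat.factorial]
  ring

theorem coeff_duality {n m r : ℕ} (Ω : Form 𝕜 n (m + m)) (F : Form 𝕜 n (m + r))
    (K : Fin (m + r) → Fin n) :
    coeff (duality m r Ω F) K = ∑ J : Fin m → Fin n,
      coeff (antisymm (insert (fun a => e (J a)) Ω) (insert (fun a => e (J a)) F)) K := by
  rw [← coeff_sum]
  rfl

theorem coeff_bTheta3 (F : Form 𝕜 8 3) (l m n : Fin 8) :
    coeff (bTheta3 𝕜 F) ![l, m, n] =
      3⁻¹ * (pairSum (fun i j => coeff F ![i, j, n]) l m +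
        pairSum (fun i j => coeff F ![i, j, l]) m n -
        pairSum (fun i j => coeff F ![i, j, m]) l n) := by
  have h := coeff_duality (m := 2) (r := 1) (Theta 𝕜) F ![l, m, n]
  refine h.trans ?_
  rw [sum_vec_two]
  simp only [coeff_antisymm_two_one, pairSum]
  rw [← Finset.sum_add_distrib, ← Finset.sum_sub_distrib, Finset.mul_sum]
  refine Finset.sum_congr rfl fun i _ => ?_
  rw [← Finset.sum_add_distrib, ← Finset.sum_sub_distrib, Finset.mul_sum]
  refine Finset.sum_congr rfl fun j _ => ?_
  have hΘ (a b : Fin 8) : coeff (insert (p := 2) (q := 2) (fun t => e (![i, j] t)) (Theta 𝕜))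
      ![a, b] = coeff (Theta 𝕜) ![i, j, a, b] := by
    rw [coeff_insert]
    congr 1
    funext t; fin_cases t <;> rfl
  have hF (a : Fin 8) : coeff (insert (p := 2) (q := 1) (fun t => e (![i, j] t)) F)
      ![a] = coeff F ![i, j, a] := by
    rw [coeff_insert]
    congr 1
    funext t; fin_cases t <;> rfl
  rw [hΘ, hΘ, hΘ, hF, hF, hF]
  ring

set_option maxHeartbeats 4000000 in
-- This replaces a spectral analysis on three-forms: b is 2/3 on the kernel of e, and on the range
-- of ẽ, where ẽ ∘ e = -42, it is (6 - 42)/9 = -4. The proof compares all 56 components.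
theorem nine_smul_bTheta3 (F : Form 𝕜 8 3) :
    (9 : 𝕜) • bTheta3 𝕜 F = (6 : 𝕜) • F + eThetaTilde 𝕜 (eTheta 𝕜 F) := by
  refine ext_coeff_three fun l m n hlm hmn => ?_
  have hs (p : Fin 8) := pairSum_apply (fun i j => coeff F ![i, j, p])
    fun i j => coeff_swap01 F i j p
  -- The table of `pairSum` supplies triples whose first two entries increase. These four rules sort
  -- in the third entry, or discard the triple if it repeats an index.
  have h1 (i j p : Fin 8) (h : p < i) (h' : i < j) :
      coeff F ![i, j, p] = coeff F ![p, i, j] := (coeff_rot F i j p).symm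
  have h2 (i j p : Fin 8) (h : i < p) (h' : p < j) :
      coeff F ![i, j, p] = -coeff F ![i, p, j] := coeff_swap12 F i p j
  have h3 (i p : Fin 8) : coeff F ![i, p, i] = 0 :=
    coeff_eq_zero F _ (a := 0) (b := 2) rfl (by decide)
  have h4 (i p : Fin 8) : coeff F ![p, i, i] = 0 :=
    coeff_eq_zero F _ (a := 1) (b := 2) rfl (by decide)
  rw [coeff_add, coeff_smul, coeff_smul, coeff_bTheta3, coeff_eThetaTilde_of_lt _ hlm hmn]
  fin_cases l <;> fin_cases m <;>
    first | exact absurd hlm (by decide) | (clear hlm; fin_cases n) <;>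
    first | exact absurd hmn (by decide) | clear hmn
  all_goals
    simp only [Fin.zero_eta, Fin.mk_one, Fin.reduceFinMk, hs]
    simp only [oneTerm, Fin.reduceEq, and_true, and_false, if_true, if_false,
      mul_one, mul_zero, sub_zero, add_zero, zero_add, zero_sub, coeff_eTheta_apply]
    simp (disch := decide) only [h3, h4, h1, h2]
    ring

end General

/-! ### Eigenspaces of b_Θ on ℝ⁸ and their dimensions -/

/-- A diagonal entry only involves components of Θ with a repeated index. -/
theorem trace_bTheta2 {𝕜 : Type*} [RCLike 𝕜] : LinearMap.trace 𝕜 _ (bTheta2 𝕜) = 0 := by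
  rw [trace_eq_sum_coeff]
  refine Finset.sum_eq_zero fun I _ => ?_
  rw [show (I : Fin 2 → Fin 8) = ![I 0, I 1] by funext x; fin_cases x <;> rfl, coeff_bTheta2]
  refine Finset.sum_eq_zero fun i _ => Finset.sum_eq_zero fun j _ => ?_
  by_cases h0 : I 0 = i
  · rw [coeff_eq_zero (Theta 𝕜) ![i, j, I 0, I 1] (a := 0) (b := 2) h0.symm (by decide), mul_zero]
  by_cases h1 : I 1 = i
  · rw [coeff_eq_zero (Theta 𝕜) ![i, j, I 0, I 1] (a := 0) (b := 3) h1.symm (by decide), mul_zero]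
  rw [coeff_basis_eq_zero (J := ![i, j]) 0 (by
    intro b
    fin_cases b
    · exact h0
    · exact h1), zero_mul]

theorem mem_eig2 {β : ℂ} {G : Form ℂ 8 2} : G ∈ eig2 β ↔ bTheta2 ℂ G = β • G :=
  Module.End.mem_eigenspace_iff

/-- The quadratic identity makes (2 - b)/8 a projection onto this eigenspace, and its trace 2 · 28/8
is the dimension. The complementary projection (6 + b)/8 serves for the eigenvalue 2. -/
theorem finrank_eig2_neg_six : Module.finrank ℂ (eig2 (-6)) = 7 := by
  have hp : LinearMap.IsProj (eig2 (-6)) ((8 : ℂ)⁻¹ • ((2 : ℂ) • LinearMap.id - bTheta2 ℂ)) := by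
    refine ⟨fun G => ?_, fun G hG => ?_⟩
    · rw [mem_eig2]
      simp only [LinearMap.smul_apply, LinearMap.sub_apply, LinearMap.id_apply, map_smul, map_sub,
        bTheta2_sq]
      module
    · rw [mem_eig2] at hG
      simp only [LinearMap.smul_apply, LinearMap.sub_apply, LinearMap.id_apply, hG]
      module
  have ht := hp.trace
  rw [map_smul, map_sub, map_smul, trace_bTheta2, LinearMap.trace_id, finrank_form] at ht
  have h7 : ((Module.finrank ℂ (eig2 (-6)) : ℕ) : ℂ) = (7 : ℕ) := by
    rw [← ht]
    norm_num [Nat.choose]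
  exact_mod_cast h7

theorem finrank_eig2_two : Module.finrank ℂ (eig2 2) = 21 := by
  have hp : LinearMap.IsProj (eig2 2) ((8 : ℂ)⁻¹ • ((6 : ℂ) • LinearMap.id + bTheta2 ℂ)) := by
    refine ⟨fun G => ?_, fun G hG => ?_⟩
    · rw [mem_eig2]
      simp only [LinearMap.smul_apply, LinearMap.add_apply, LinearMap.id_apply, map_smul, map_add,
        bTheta2_sq]
      module
    · rw [mem_eig2] at hG
      simp only [LinearMap.smul_apply, LinearMap.add_apply, LinearMap.id_apply, hG]
      module
  have ht := hp.trace
  rw [map_smul, map_add, map_smul, trace_bTheta2, LinearMap.trace_id, finrank_form] at ht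
  have h21 : ((Module.finrank ℂ (eig2 2) : ℕ) : ℂ) = (21 : ℕ) := by
    rw [← ht]
    norm_num [Nat.choose]
  exact_mod_cast h21

theorem eThetaTilde_injective {𝕜 : Type*} [RCLike 𝕜] : Function.Injective (eThetaTilde 𝕜) := by
  rw [injective_iff_map_eq_zero]
  intro K hK
  have h := eTheta_eThetaTilde K
  rw [hK, map_zero] at h
  exact (smul_eq_zero.1 h.symm).resolve_left (by norm_num)

/-- Since 9 · (2/3) = 6, the eigenvalue equation says ẽ(e(F)) = 0, and ẽ is injective. -/
theorem eig3_eq_ker : eig3 (2 / 3) = LinearMap.ker (eTheta ℂ) := by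
  ext F
  have h9 := nine_smul_bTheta3 F
  rw [LinearMap.mem_ker, eig3, Module.End.mem_eigenspace_iff]
  constructor
  · intro h
    apply eThetaTilde_injective
    rw [h] at h9
    rw [map_zero]
    linear_combination (norm := module) -h9
  · intro h
    rw [h, map_zero, add_zero] at h9
    linear_combination (norm := module) (9 : ℂ)⁻¹ • h9

theorem finrank_eig3 : Module.finrank ℂ (eig3 (2 / 3)) = 48 := by
  have hs : LinearMap.range (eTheta ℂ) = ⊤ := by
    rw [LinearMap.range_eq_top]
    intro K
    refine ⟨(-42 : ℂ)⁻¹ • eThetaTilde ℂ K, ?_⟩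
    rw [map_smul, eTheta_eThetaTilde, smul_smul]
    norm_num
  have h := LinearMap.finrank_range_add_finrank_ker (eTheta ℂ)
  rw [hs, finrank_top, finrank_form, finrank_form, ← eig3_eq_ker] at h
  norm_num [Nat.choose] at h
  omega

/-! ### Eigenvalue equations and eigenspaces of b_Θ̂ -/

theorem partsOp_eq_smul_iff {𝕜 : Type*} [RCLike 𝕜] {μ : 𝕜} {F : Form 𝕜 8 3} {G H : Form 𝕜 8 2}
    {K : Form 𝕜 8 1} : partsOp 𝕜 (F, G, H, K) = μ • (F, G, H, K) ↔
      (6 : 𝕜) • eThetaTilde 𝕜 K = μ • F ∧ (-3 : 𝕜) • bTheta2 𝕜 H = μ • G ∧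
      (3 : 𝕜) • bTheta2 𝕜 G = μ • H ∧ eTheta 𝕜 F = μ • K := by
  rw [partsOp, Prod.smul_mk, Prod.smul_mk, Prod.smul_mk, Prod.mk.injEq, Prod.mk.injEq,
    Prod.mk.injEq]

theorem mem_eigenspace_iff_parts {μ : ℂ} {Ψ : Form ℂ 10 3} :
    Ψ ∈ (bThetaHat ℂ).eigenspace μ ↔ partsOp ℂ (parts ℂ Ψ) = μ • parts ℂ Ψ := by
  rw [Module.End.mem_eigenspace_iff, ← parts_injective.eq_iff, parts_bThetaHat, map_smul]

/-- The eigenvalue equation on the summands `Λ³ℝ⁸` and `ℝ⁸ ⊗ Λ²ℝ²`. -/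
theorem smul_sq_of_eTheta {μ : ℂ} {F : Form ℂ 8 3} {K : Form ℂ 8 1}
    (h₁ : (6 : ℂ) • eThetaTilde ℂ K = μ • F) (h₂ : eTheta ℂ F = μ • K) :
    (μ * μ + 252) • K = 0 := by
  have h := congrArg (eTheta ℂ) h₁
  rw [map_smul, map_smul, eTheta_eThetaTilde, h₂] at h
  linear_combination (norm := module) -h

/-- The eigenvalue equation on the summand `Λ²ℝ⁸ ⊗ ℝ²`. -/
theorem smul_bTheta2_of_eigen {μ : ℂ} {G H : Form ℂ 8 2}
    (h₁ : (-3 : ℂ) • bTheta2 ℂ H = μ • G) (h₂ : (3 : ℂ) • bTheta2 ℂ G = μ • H) :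
    (36 : ℂ) • bTheta2 ℂ G = (μ * μ + 108) • G := by
  have h := congrArg (bTheta2 ℂ) h₂
  rw [map_smul, map_smul, bTheta2_sq] at h
  linear_combination (norm := module) (-3 : ℂ) • h + μ • h₁

theorem eq_zero_of_bTheta2_eq {ν : ℂ} {G : Form ℂ 8 2} (h : bTheta2 ℂ G = ν • G)
    (hν : ν * ν + 4 * ν - 12 ≠ 0) : G = 0 := by
  have h2 := bTheta2_sq G
  rw [h, map_smul, h] at h2
  have : (ν * ν + 4 * ν - 12) • G = 0 := by linear_combination (norm := module) h2
  exact (smul_eq_zero.1 this).resolve_left hν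

/-- The one-form on `ℝ²` that spans the eigenspace of `*` for the eigenvalue `s`, `s² = -1`. -/
def starVec (s : ℂ) : Form ℂ 2 1 := dual2 ℂ 0 - s • dual2 ℂ 1

theorem coeff_starVec_zero (s : ℂ) : coeff (starVec s) ![0] = 1 := by
  simp [starVec, coeff_dual2]

theorem coeff_starVec_one (s : ℂ) : coeff (starVec s) ![1] = -s := by
  simp [starVec, coeff_dual2]

theorem eigenspace_star1 {s : ℂ} (hs : s * s = -1) :
    (star1 ℂ).eigenspace s = Submodule.span ℂ {starVec s} := by
  ext ω
  rw [Module.End.mem_eigenspace_iff, Submodule.mem_span_singleton]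
  constructor
  · intro h
    refine ⟨coeff ω ![0], ext_coeff_one fun b => ?_⟩
    have h0 := congrArg (fun ω => coeff ω ![0]) h
    simp only [coeff_star1, Fin.sum_univ_two, coeff_eps, coeff_smul] at h0
    norm_num at h0
    rw [coeff_smul]
    fin_cases b
    · exact (congrArg _ (coeff_starVec_zero s)).trans (mul_one _)
    · refine (congrArg _ (coeff_starVec_one s)).trans ?_
      change coeff ω ![0] * -s = coeff ω ![1]
      linear_combination h0
  · rintro ⟨c, rfl⟩
    rw [map_smul, starVec, map_sub, map_smul, star1_dual2_zero, star1_dual2_one]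
    have : (s * s) • dual2 ℂ 1 = -dual2 ℂ 1 := by rw [hs, neg_one_smul]
    linear_combination (norm := module) c • this

/-- `G ↦ G ∧ ω` for `ω` in the `s`-eigenspace of `*`. -/
def joinStar (s : ℂ) : Form ℂ 8 2 →ₗ[ℂ] Form ℂ 10 3 := (join 2 1).flip (starVec s)

theorem parts_joinStar (s : ℂ) (G : Form ℂ 8 2) :
    parts ℂ (joinStar s G) = (0, G, -s • G, 0) := by
  change parts ℂ (join 2 1 G (starVec s)) = _
  rw [parts_join_two_one, coeff_starVec_zero, coeff_starVec_one, one_smul]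

theorem joinStar_injective (s : ℂ) : Function.Injective (joinStar s) := by
  intro G G' h
  have := congrArg (fun Ψ => (parts ℂ Ψ).2.1) h
  simpa only [parts_joinStar] using this

theorem tens_eigenspace_star1 {s : ℂ} (hs : s * s = -1) (A : Submodule ℂ (Form ℂ 8 2)) :
    tens A ((star1 ℂ).eigenspace s) = A.map (joinStar s) := by
  rw [eigenspace_star1 hs, tens, Submodule.map₂_span_singleton_eq_map_flip]
  rfl

/-- With μ = 3βs one has μ² = -9β². The condition β² ≠ 28 says μ² ≠ -252, which kills K and then F.
Eliminating H gives b(G) = βG, and H = -sG means that the form is G ∧ (e₉ - s e₁₀). -/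
theorem eigenspace_eq_tens {s β : ℂ} (hs : s * s = -1) (hβ : β * β + 4 * β = 12)
    (hβ' : β * β ≠ 28) : (bThetaHat ℂ).eigenspace (3 * β * s) =
      tens (eig2 β) ((star1 ℂ).eigenspace s) := by
  have hβ0 : β ≠ 0 := by rintro rfl; norm_num at hβ
  have hs0 : s ≠ 0 := by rintro rfl; norm_num at hs
  have hμ : 3 * β * s ≠ 0 := mul_ne_zero (mul_ne_zero (by norm_num) hβ0) hs0
  rw [tens_eigenspace_star1 hs]
  ext Ψ
  rw [mem_eigenspace_iff_parts, Submodule.mem_map]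
  constructor
  · intro h
    rcases hp : parts ℂ Ψ with ⟨F, G, H, K⟩
    rw [hp] at h
    obtain ⟨hF, hG, hH, hK⟩ := partsOp_eq_smul_iff.1 h
    have hK0 : K = 0 := (smul_eq_zero.1 (smul_sq_of_eTheta hF hK)).resolve_left fun h0 =>
      hβ' (by linear_combination (-1 / 9 : ℂ) * h0 + β * β * hs)
    have hF0 : F = 0 := by
      rw [hK0, map_zero, smul_zero] at hF
      exact (smul_eq_zero.1 hF.symm).resolve_left hμ
    have hb := smul_bTheta2_of_eigen hG hH
    rw [show 3 * β * s * (3 * β * s) + 108 = 36 * β by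
      linear_combination 9 * β * β * hs - 9 * hβ] at hb
    have hbG : bTheta2 ℂ G = β • G := by linear_combination (norm := module) (36 : ℂ)⁻¹ • hb
    refine ⟨G, mem_eig2.2 hbG, parts_injective ?_⟩
    rw [parts_joinStar, hp, hF0, hK0]
    have : -s • G = H := by
      rw [hbG] at hH
      apply smul_right_injective _ hμ
      change (3 * β * s) • (-s • G) = (3 * β * s) • H
      rw [← hH, smul_smul, smul_smul]
      congr 1
      linear_combination -3 * β * hs
    rw [this]
  · rintro ⟨G, hG, rfl⟩
    rw [mem_eig2] at hG
    rw [parts_joinStar]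
    have h1 : bTheta2 ℂ (-s • G) = (-s * β) • G := by rw [map_smul, hG, smul_smul]
    refine partsOp_eq_smul_iff.2 ⟨?_, ?_, ?_, ?_⟩
    · simp
    · rw [h1]
      module
    · rw [hG, smul_smul, smul_smul]
      congr 1
      linear_combination 3 * β * hs
    · simp

theorem finrank_eigenspace_eq {s β : ℂ} (hs : s * s = -1) (hβ : β * β + 4 * β = 12)
    (hβ' : β * β ≠ 28) : Module.finrank ℂ ((bThetaHat ℂ).eigenspace (3 * β * s)) =
      Module.finrank ℂ (eig2 β) := by
  rw [eigenspace_eq_tens hs hβ hβ', tens_eigenspace_star1 hs]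
  exact (Submodule.equivMapOfInjective _ (joinStar_injective s) _).finrank_eq.symm

theorem parts_mixed (c : ℂ) (F : Form ℂ 8 1) :
    parts ℂ (mixed c F) = (c • eThetaTilde ℂ F, 0, 0, F) := by
  rw [mixed, map_add, parts_pull8, parts_join_one_two, coeff_eps]
  simp

/-- `mixed c` as a linear map. -/
def mixedLinear (c : ℂ) : Form ℂ 8 1 →ₗ[ℂ] Form ℂ 10 3 :=
  pull8 ∘ₗ (c • eThetaTilde ℂ) + (join 1 2).flip (eps ℂ)

theorem mixedLinear_apply (c : ℂ) (F : Form ℂ 8 1) : mixedLinear c F = mixed c F := rfl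

theorem mixedLinear_injective (c : ℂ) : Function.Injective (mixedLinear c) := by
  intro F F' h
  have := congrArg (fun Ψ => (parts ℂ Ψ).2.2.2) h
  simpa only [mixedLinear_apply, parts_mixed] using this

/-- The first equation gives F = (6/μ) ẽ(K), and e ∘ ẽ = -42 makes the last one automatic since 6 ·
(-42) = μ². -/
theorem eigenspace_eq_range {μ c : ℂ} (hμ : μ * μ = -252) (hc : μ * c = 6) :
    (bThetaHat ℂ).eigenspace μ = LinearMap.range (mixedLinear c) := by
  have hμ0 : μ ≠ 0 := by rintro rfl; norm_num at hμ
  ext Ψ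
  rw [mem_eigenspace_iff_parts, LinearMap.mem_range]
  constructor
  · intro h
    rcases hp : parts ℂ Ψ with ⟨F, G, H, K⟩
    rw [hp] at h
    obtain ⟨hF, hG, hH, -⟩ := partsOp_eq_smul_iff.1 h
    have hb := smul_bTheta2_of_eigen hG hH
    rw [hμ] at hb
    -- Here (μ² + 108)/36 = -4, which is neither 2 nor -6.
    have hG0 : G = 0 := eq_zero_of_bTheta2_eq (ν := -4)
      (by linear_combination (norm := module) (36 : ℂ)⁻¹ • hb) (by norm_num)
    have hH0 : H = 0 := by
      rw [hG0, map_zero, smul_zero] at hH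
      exact (smul_eq_zero.1 hH.symm).resolve_left hμ0
    have hFK : c • eThetaTilde ℂ K = F := by
      apply smul_right_injective _ hμ0
      change μ • c • eThetaTilde ℂ K = μ • F
      rw [smul_smul, hc, hF]
    refine ⟨K, parts_injective ?_⟩
    rw [mixedLinear_apply, parts_mixed, hp, hG0, hH0, hFK]
  · rintro ⟨K, rfl⟩
    rw [mixedLinear_apply, parts_mixed]
    refine partsOp_eq_smul_iff.2 ⟨?_, ?_, ?_, ?_⟩
    · rw [smul_smul, hc]
    · simp
    · simp
    · rw [map_smul, eTheta_eThetaTilde, smul_smul]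
      congr 1
      apply mul_left_cancel₀ hμ0
      linear_combination -42 * hc - hμ

theorem finrank_eigenspace_mixed {μ c : ℂ} (hμ : μ * μ = -252) (hc : μ * c = 6) :
    Module.finrank ℂ ((bThetaHat ℂ).eigenspace μ) = 8 := by
  rw [eigenspace_eq_range hμ hc, LinearMap.finrank_range_of_inj (mixedLinear_injective c),
    finrank_form]
  rfl

theorem pull8_injective : Function.Injective (pull8 : Form ℂ 8 3 →ₗ[ℂ] Form ℂ 10 3) := by
  intro F F' h
  have := congrArg (fun Ψ => (parts ℂ Ψ).1) h
  simpa only [parts_pull8] using this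

/-- Neither b on two-forms nor ẽ has a kernel, so only F survives, subject to e(F) = 0. -/
theorem eigenspace_zero : (bThetaHat ℂ).eigenspace 0 = (eig3 (2 / 3)).map pull8 := by
  ext Ψ
  rw [mem_eigenspace_iff_parts, eig3_eq_ker, Submodule.mem_map]
  constructor
  · intro h
    rcases hp : parts ℂ Ψ with ⟨F, G, H, K⟩
    rw [hp] at h
    obtain ⟨hF, hG, hH, hK⟩ := partsOp_eq_smul_iff.1 h
    rw [zero_smul] at hF hG hH hK
    have hb {G : Form ℂ 8 2} (h : bTheta2 ℂ G = 0) : G = 0 :=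
      eq_zero_of_bTheta2_eq (ν := 0) (by rw [h, zero_smul]) (by norm_num)
    have hG0 : G = 0 := hb ((smul_eq_zero.1 hH).resolve_left (by norm_num))
    have hH0 : H = 0 := hb ((smul_eq_zero.1 hG).resolve_left (by norm_num))
    have hK0 : K = 0 := eThetaTilde_injective
      (((smul_eq_zero.1 hF).resolve_left (by norm_num)).trans (map_zero _).symm)
    exact ⟨F, hK, parts_injective (by rw [parts_pull8, hp, hG0, hH0, hK0])⟩
  · rintro ⟨F, hF, rfl⟩
    rw [LinearMap.mem_ker] at hF
    rw [parts_pull8, partsOp_eq_smul_iff]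
    simp [hF]

theorem finrank_eigenspace_zero : Module.finrank ℂ ((bThetaHat ℂ).eigenspace 0) = 48 := by
  rw [eigenspace_zero, ← finrank_eig3]
  exact (Submodule.equivMapOfInjective _ pull8_injective _).finrank_eq.symm

/-! ### The spectrum and the final assembly -/

theorem sq_of_hasEigenvalue {μ : ℂ} (h : (bThetaHat ℂ).HasEigenvalue μ) :
    μ = 0 ∨ μ * μ = -252 ∨ μ * μ = -324 ∨ μ * μ = -36 := by
  obtain ⟨Ψ, hΨ, hne⟩ := h.exists_hasEigenvector
  rw [mem_eigenspace_iff_parts] at hΨ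
  by_contra! hc
  obtain ⟨h0, h1, h2, h3⟩ := hc
  apply hne
  rcases hp : parts ℂ Ψ with ⟨F, G, H, K⟩
  rw [hp] at hΨ
  obtain ⟨hF, hG, hH, hK⟩ := partsOp_eq_smul_iff.1 hΨ
  have hK0 : K = 0 := (smul_eq_zero.1 (smul_sq_of_eTheta hF hK)).resolve_left fun h =>
    h1 (by linear_combination h)
  have hF0 : F = 0 := by
    rw [hK0, map_zero, smul_zero] at hF
    exact (smul_eq_zero.1 hF.symm).resolve_left h0
  have hb := smul_bTheta2_of_eigen hG hH
  have hG0 : G = 0 := by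
    -- G would be an eigenvector of b with this eigenvalue, and ν² + 4ν - 12 is (μ² + 324)(μ² +
    -- 36)/1296.
    refine eq_zero_of_bTheta2_eq (ν := (μ * μ + 108) / 36) ?_ fun hν => ?_
    · linear_combination (norm := module) (36 : ℂ)⁻¹ • hb
    · have : (μ * μ + 324) * (μ * μ + 36) = 0 := by linear_combination 1296 * hν
      rcases mul_eq_zero.1 this with h | h
      · exact h2 (by linear_combination h)
      · exact h3 (by linear_combination h)
  have hH0 : H = 0 := by
    rw [hG0, map_zero, smul_zero] at hH
    exact (smul_eq_zero.1 hH.symm).resolve_left h0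
  apply parts_injective
  rw [hp, hF0, hG0, hH0, hK0, map_zero]
  rfl

theorem hasEigenvalue_of_finrank {V : Type*} [AddCommGroup V] [Module ℂ V] {T : Module.End ℂ V}
    {μ : ℂ} (h : Module.finrank ℂ (T.eigenspace μ) ≠ 0) : T.HasEigenvalue μ := by
  rw [Module.End.hasEigenvalue_iff]
  rintro h0
  rw [h0, finrank_bot] at h
  exact h rfl

end Form

end

open Complex Form in
theorem proposition3p11 (𝕜 : Type*) [RCLike 𝕜] :
    -- the decomposition, and the block form with respect to it
    (Function.Bijective (assemble 𝕜) ∧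
      bThetaHat 𝕜 ∘ₗ assemble 𝕜 = assemble 𝕜 ∘ₗ blockOp 𝕜) ∧
    -- the eigenvalues, over `ℂ`
    (∀ μ : ℂ, (bThetaHat ℂ).HasEigenvalue μ ↔
      μ ∈ ({0, 18 * I, -(18 * I), 6 * I, -(6 * I),
        6 * (√7 : ℝ) * I, -(6 * (√7 : ℝ) * I)} : Set ℂ)) ∧
    -- the eigenspaces
    ((bThetaHat ℂ).eigenspace 0 = (eig3 (2 / 3)).map pull8 ∧
      (bThetaHat ℂ).eigenspace (18 * I) = tens (eig2 (-6)) RMinus ∧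
      (bThetaHat ℂ).eigenspace (-(18 * I)) = tens (eig2 (-6)) RPlus ∧
      (bThetaHat ℂ).eigenspace (6 * I) = tens (eig2 2) RPlus ∧
      (bThetaHat ℂ).eigenspace (-(6 * I)) = tens (eig2 2) RMinus ∧
      ((bThetaHat ℂ).eigenspace (6 * (√7 : ℝ) * I) : Set (Form ℂ 10 3)) =
        Set.range (mixed (-(I / (√7 : ℝ)))) ∧
      ((bThetaHat ℂ).eigenspace (-(6 * (√7 : ℝ) * I)) : Set (Form ℂ 10 3)) =
        Set.range (mixed (I / (√7 : ℝ)))) ∧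
    -- their dimensions
    (Module.finrank ℂ ((bThetaHat ℂ).eigenspace 0) = 48 ∧
      Module.finrank ℂ ((bThetaHat ℂ).eigenspace (18 * I)) = 7 ∧
      Module.finrank ℂ ((bThetaHat ℂ).eigenspace (-(18 * I))) = 7 ∧
      Module.finrank ℂ ((bThetaHat ℂ).eigenspace (6 * I)) = 21 ∧
      Module.finrank ℂ ((bThetaHat ℂ).eigenspace (-(6 * I))) = 21 ∧
      Module.finrank ℂ ((bThetaHat ℂ).eigenspace (6 * (√7 : ℝ) * I)) = 8 ∧
      Module.finrank ℂ ((bThetaHat ℂ).eigenspace (-(6 * (√7 : ℝ) * I))) = 8) := by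
  have h7 : ((√7 : ℝ) : ℂ) * ((√7 : ℝ) : ℂ) = 7 := by
    rw [← ofReal_mul, Real.mul_self_sqrt (by norm_num)]
    norm_num
  have h70 : ((√7 : ℝ) : ℂ) ≠ 0 := by
    intro h
    rw [h] at h7
    norm_num at h7
  have hI : I * I = -1 := I_mul_I
  have hI' : -I * -I = -1 := by rw [neg_mul_neg, I_mul_I]
  -- Writing each eigenvalue as 3βs shows the pairing of signs: the negative β = -6 reverses the
  -- sign of s, while β = 2 keeps it.
  have m1 : 18 * I = 3 * (-6) * -I := by ring
  have m2 : -(18 * I) = 3 * (-6) * I := by ring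
  have m3 : 6 * I = 3 * 2 * I := by ring
  have m4 : -(6 * I) = 3 * 2 * -I := by ring
  have q1 : 6 * (√7 : ℝ) * I * (6 * (√7 : ℝ) * I) = -252 := by
    linear_combination 36 * I * I * h7 + 252 * hI
  have q2 : -(6 * (√7 : ℝ) * I) * -(6 * (√7 : ℝ) * I) = -252 := by
    linear_combination 36 * I * I * h7 + 252 * hI
  -- The coefficient of ẽ(F) in the eigenvector is 6/μ.
  have c1 : 6 * (√7 : ℝ) * I * -(I / (√7 : ℝ)) = 6 := by
    field_simp
    linear_combination -hI
  have c2 : -(6 * (√7 : ℝ) * I) * (I / (√7 : ℝ)) = 6 := by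
    field_simp
    linear_combination -hI
  have b1 : (-6 : ℂ) * -6 + 4 * -6 = 12 := by norm_num
  have b2 : (2 : ℂ) * 2 + 4 * 2 = 12 := by norm_num
  have b1' : (-6 : ℂ) * -6 ≠ 28 := by norm_num
  have b2' : (2 : ℂ) * 2 ≠ 28 := by norm_num
  have d1 : Module.finrank ℂ ((bThetaHat ℂ).eigenspace (18 * I)) = 7 := by
    rw [m1, finrank_eigenspace_eq hI' b1 b1', finrank_eig2_neg_six]
  have d2 : Module.finrank ℂ ((bThetaHat ℂ).eigenspace (-(18 * I))) = 7 := by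
    rw [m2, finrank_eigenspace_eq hI b1 b1', finrank_eig2_neg_six]
  have d3 : Module.finrank ℂ ((bThetaHat ℂ).eigenspace (6 * I)) = 21 := by
    rw [m3, finrank_eigenspace_eq hI b2 b2', finrank_eig2_two]
  have d4 : Module.finrank ℂ ((bThetaHat ℂ).eigenspace (-(6 * I))) = 21 := by
    rw [m4, finrank_eigenspace_eq hI' b2 b2', finrank_eig2_two]
  have d5 := finrank_eigenspace_mixed q1 c1
  have d6 := finrank_eigenspace_mixed q2 c2
  refine ⟨⟨assemble_bijective, bThetaHat_comp_assemble⟩, fun μ => ⟨fun h => ?_, ?_⟩,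
    ⟨eigenspace_zero, ?_, ?_, ?_, ?_, ?_, ?_⟩, finrank_eigenspace_zero, d1, d2, d3, d4, d5, d6⟩
  · have root {z : ℂ} (h : μ * μ = z * z) : μ = z ∨ μ = -z := mul_self_eq_mul_self_iff.1 h
    simp only [Set.mem_insert_iff, Set.mem_singleton_iff]
    rcases sq_of_hasEigenvalue h with h | h | h | h
    · exact Or.inl h
    · have := root (h.trans q1.symm)
      tauto
    · have := root (z := 18 * I) (by linear_combination h - 324 * hI)
      tauto
    · have := root (z := 6 * I) (by linear_combination h - 36 * hI)
      tauto
  · rintro (rfl | rfl | rfl | rfl | rfl | rfl | rfl) <;> apply hasEigenvalue_of_finrank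
    · rw [finrank_eigenspace_zero]; norm_num
    · rw [d1]; norm_num
    · rw [d2]; norm_num
    · rw [d3]; norm_num
    · rw [d4]; norm_num
    · rw [d5]; norm_num
    · rw [d6]; norm_num
  · rw [m1, eigenspace_eq_tens hI' b1 b1']; rfl
  · rw [m2, eigenspace_eq_tens hI b1 b1']; rfl
  · rw [m3, eigenspace_eq_tens hI b2 b2']; rfl
  · rw [m4, eigenspace_eq_tens hI' b2 b2']; rfl
  · rw [eigenspace_eq_range q1 c1]; rfl
  · rw [eigenspace_eq_range q2 c2]; rfl
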